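/- Let $\Bbbk$ be a field of characteristic zero, let $a,b,p,q,t\in\Bbbk$ with $t\neq 0$, and let $V$ be the $\Bbbk$-vector space with basis $x_1,x_2,x_3$. Let $c\in GL(V\otimes V)$ be the braiding associated to the $R$-matrix $\mathfrak{R}_{1,3}$, that is, $$\begin{aligned} c(x_1\otimes x_1)&=t\,x_1\otimes x_1, & c(x_2\otimes x_1)&=t\,x_1\otimes x_2, & c(x_3\otimes x_1)&=t\,x_1\otimes x_3+ta\,x_1\otimes x_1,\\ c(x_1\otimes x_2)&=t\,x_2\otimes x_1, & c(x_2\otimes x_2)&=t\,x_2\otimes x_2, & c(x_3\otimes x_2)&=t\,x_2\otimes x_3+tb\,x_2\otimes x_1,\\ c(x_1\otimes x_3)&=t\,x_3\otimes x_1-ta\,x_1\otimes x_1, & c(x_2\otimes x_3)&=t\,x_3\otimes x_2-tb\,x_1\otimes x_2, \end{aligned}$$ $$c(x_3\otimes x_3)=t\,x_3\otimes x_3+tb\,x_3\otimes x_1+tq\,x_2\otimes x_2+tp\,x_2\otimes x_1-tb\,x_1\otimes x_3-tp\,x_1\otimes x_2-tab\,x_1\otimes x_1 .$$ Let $\mathfrak{B}(V)=T(V)/\mathcal{J}(V)$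 be its Nichols algebra, where $\mathcal{J}(V)=\bigoplus_{n\ge 2}\mathcal{J}_n(V)$ and $\mathcal{J}_n(V)\subseteq V^{\otimes n}$ is the kernel of the quantum symmetrizer $Q_n=\sum_{\sigma\in\mathbb{S}_n}\rho_n(M(\sigma))$. Here $\rho_n$ is the representation of the braid group $\mathbb{B}_n$ on $V^{\otimes n}$ induced by $c$, and $M:\mathbb{S}_n\to\mathbb{B}_n$ is the Matsumoto section. Let $\operatorname{GKdim}$ denote the Gelfand-Kirillov dimension. Then: 1. If $t^2\neq 1$, then $\mathfrak{B}(V)$ has no quadratic relations, i.e. $\mathcal{J}_2(V)=0$. 2. If $t=1$, then $$\mathcal{J}(V)=\langle x_2x_1-x_1x_2,\ x_3x_1-x_1x_3-a\,x_1^2,\ x_3x_2-x_2x_3-b\,x_1x_2\rangle,$$ the set $B_3=\{x_1^{a_1}x_2^{a_2}x_3^{a_3}: a_i\ge 0\}$ is a basis of $\mathfrak{B}(V)$, and $\operatorname{GKdim}\mathfrak{B}(V)=3$. 3. If $t=-1$ and $q\neq 0$, then $$\mathcal{J}(V)=\langle x_2x_1+x_1x_2,\ x_3x_1+x_1x_3,\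 x_3x_2+x_2x_3-b\,x_1x_2,\ x_1^2,\ x_2^2\rangle,$$ the set $B_1=\{x_1^{a_1}x_2^{a_2}x_3^{a_3}: a_i\ge 0,\ a_1,a_2<2\}$ is a basis of $\mathfrak{B}(V)$, and $\operatorname{GKdim}\mathfrak{B}(V)=1$. 4. If $t=-1$ and $q=0$, then $$\mathcal{J}(V)=\langle x_2x_1+x_1x_2,\ x_3x_1+x_1x_3,\ x_3x_2+x_2x_3-b\,x_1x_2,\ x_1^2,\ x_2^2,\ x_3^2-b\,x_1x_3-p\,x_1x_2\rangle,$$ the set $B_0=\{x_1^{a_1}x_2^{a_2}x_3^{a_3}: 0\le a_i<2\}$ is a basis of $\mathfrak{B}(V)$, $\operatorname{GKdim}\mathfrak{B}(V)=0$ and $\dim\mathfrak{B}(V)=8$. -/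

import Mathlib

open scoped TensorProduct

namespace Nichols

/-! ### Braided vector spaces -/

/-- A braiding on the `k`-vector space `V`: an invertible linear endomorphism `c` of `V ⊗ V` with
`(c ⊗ id)(id ⊗ c)(c ⊗ id) = (id ⊗ c)(c ⊗ id)(id ⊗ c)` on `V ⊗ V ⊗ V`. -/
structure Braiding (k V : Type*) [Field k] [AddCommGroup V] [Module k V] where
  /-- the map `c` -/
  toMap : V ⊗[k] V →ₗ[k] V ⊗[k] V
  bijective : Function.Bijective toMap
  braid_eq :
    let c₁ : Module.End k (V ⊗[k] (V ⊗[k] V)) :=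
      (TensorProduct.assoc k V V V).toLinearMap ∘ₗ toMap.rTensor V ∘ₗ
        (TensorProduct.assoc k V V V).symm.toLinearMap
    let c₂ : Module.End k (V ⊗[k] (V ⊗[k] V)) := toMap.lTensor V
    c₁ * c₂ * c₁ = c₂ * c₁ * c₂

/-! ### Reduced words in the symmetric group -/

/-- The simple transposition `s_i = (i  i+1)` of `{0, …, n - 1}`
(the identity if `i + 1 ≥ n`, a case that never occurs below). -/
def simpleTransposition (n i : ℕ) : Equiv.Perm (Fin n) :=
  if h : i + 1 < n then Equiv.swap ⟨i, Nat.lt_of_succ_lt h⟩ ⟨i + 1, h⟩ else 1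

/-- `w = [i₁, …, i_l]` is a reduced word of `σ`: `σ = s_{i₁} ⋯ s_{i_l}`, and no shorter word in the
simple transpositions has product `σ`. -/
def IsReducedWord {n : ℕ} (σ : Equiv.Perm (Fin n)) (w : List ℕ) : Prop :=
  (∀ i ∈ w, i + 1 < n) ∧ (w.map (simpleTransposition n)).prod = σ ∧
    ∀ w' : List ℕ, (w'.map (simpleTransposition n)).prod = σ → w.length ≤ w'.length

/-- Delete `j` from the domain of `σ` and `σ j` from its codomain, and renumber increasingly. -/
def removeAt {n : ℕ} (σ : Equiv.Perm (Fin (n + 1))) (j : Fin (n + 1)) : Equiv.Perm (Fin n) :=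
  Equiv.removeNone ((finSuccEquiv' j).symm.trans (σ.trans (finSuccEquiv' (σ j))))

/-- A reduced word of `σ` (see `isReducedWord_reducedWord`): with `j = σ⁻¹(0)` and `σ'` the
permutation left when `j ↦ 0` is removed from `σ`, write `σ = (1 ⊕ σ') ∘ s_0 s_1 ⋯ s_{j-1}`. -/
def reducedWord : (n : ℕ) → Equiv.Perm (Fin n) → List ℕ
  | 0, _ => []
  | n + 1, σ => (reducedWord n (removeAt σ (σ.symm 0))).map Nat.succ ++
      List.range (σ.symm 0 : ℕ)

theorem simpleTransposition_val (n i : ℕ) (h : i + 1 < n) (x : Fin n) :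
    (simpleTransposition n i x : ℕ) =
      if (x : ℕ) = i then i + 1 else if (x : ℕ) = i + 1 then i else x := by
  simp only [simpleTransposition, dif_pos h, Equiv.swap_apply_def, Fin.ext_iff]
  split_ifs <;> simp_all

theorem removeAt_spec {n : ℕ} (σ : Equiv.Perm (Fin (n + 1))) (j : Fin (n + 1)) (x : Fin n) :
    σ (j.succAbove x) = (σ j).succAbove (removeAt σ j x) := by
  have h := Equiv.removeNone_some
    ((finSuccEquiv' j).symm.trans (σ.trans (finSuccEquiv' (σ j)))) (x := x) ?_
  · simp only [Equiv.trans_apply, finSuccEquiv'_symm_some] at h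
    rw [← finSuccEquiv'_symm_some (σ j), Equiv.eq_symm_apply, ← h]
    rfl
  · simp only [Equiv.trans_apply, finSuccEquiv'_symm_some]
    obtain ⟨y, hy⟩ := Fin.exists_succAbove_eq (x := σ (j.succAbove x)) (y := σ j)
      (by simp [Fin.succAbove_ne])
    exact ⟨y, by rw [← hy, finSuccEquiv'_succAbove]⟩

theorem removeAt_unique {n : ℕ} (σ : Equiv.Perm (Fin (n + 1))) (j : Fin (n + 1))
    (τ : Equiv.Perm (Fin n)) (h : ∀ x, σ (j.succAbove x) = (σ j).succAbove (τ x)) :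
    removeAt σ j = τ := by
  ext x
  have := (removeAt_spec σ j x).symm.trans (h x)
  rw [Fin.succAbove_right_injective this]

theorem reducedWord_lt (n : ℕ) (σ : Equiv.Perm (Fin n)) : ∀ i ∈ reducedWord n σ, i + 1 < n := by
  induction n with
  | zero => simp [reducedWord]
  | succ n ih =>
    intro i hi
    simp only [reducedWord, List.mem_append, List.mem_map, List.mem_range] at hi
    rcases hi with ⟨a, ha, rfl⟩ | hi
    · have := ih _ a ha
      omega
    · have := (σ.symm 0).isLt
      omega

theorem prod_range_val (n : ℕ) : ∀ (j : ℕ) (_ : j < n) (x : Fin n),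
    ((((List.range j).map (simpleTransposition n)).prod x : Fin n) : ℕ) =
      if (x : ℕ) < j then (x : ℕ) + 1 else if (x : ℕ) = j then 0 else x := by
  intro j
  induction j with
  | zero => intro _ x; simp
  | succ j ih =>
    intro hj x
    rw [List.range_succ, List.map_append, List.prod_append, Equiv.Perm.mul_apply, ih (by omega)]
    simp only [List.map_cons, List.map_nil, List.prod_singleton, simpleTransposition_val n j hj]
    split_ifs <;> omega

theorem prod_map_succ (n : ℕ) (w : List ℕ) (hw : ∀ i ∈ w, i + 1 < n) :
    ((w.map Nat.succ).map (simpleTransposition (n + 1))).prod 0 = 0 ∧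
    ∀ x : Fin n, ((w.map Nat.succ).map (simpleTransposition (n + 1))).prod x.succ =
      ((w.map (simpleTransposition n)).prod x).succ := by
  induction w with
  | nil => simp
  | cons i w ih =>
    have h1 := hw i (by simp)
    obtain ⟨h0, hs⟩ := ih (fun a ha => hw a (by simp [ha]))
    refine ⟨?_, fun x => ?_⟩
    · simp only [List.map_cons, List.prod_cons, Equiv.Perm.mul_apply] at h0 ⊢
      rw [h0]
      ext
      rw [simpleTransposition_val _ _ (by omega)]
      simp
    · simp only [List.map_cons, List.prod_cons, Equiv.Perm.mul_apply] at hs ⊢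
      rw [hs]
      ext
      rw [simpleTransposition_val _ _ (by omega), Fin.val_succ, Fin.val_succ,
        simpleTransposition_val _ _ h1]
      split_ifs <;> omega

theorem prod_reducedWord (n : ℕ) (σ : Equiv.Perm (Fin n)) :
    ((reducedWord n σ).map (simpleTransposition n)).prod = σ := by
  induction n with
  | zero => exact Subsingleton.elim _ _
  | succ n ih =>
    set j := σ.symm 0 with hj
    have hσ : σ j = 0 := by simp [hj]
    obtain ⟨h0, hs⟩ := prod_map_succ n (reducedWord n (removeAt σ j)) (reducedWord_lt n _)
    rw [ih] at hs
    simp only [reducedWord, List.map_append, List.prod_append, ← hj]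
    refine Equiv.ext fun y => ?_
    rw [Equiv.Perm.mul_apply]
    have hr := prod_range_val (n + 1) j j.isLt y
    rcases eq_or_ne y j with hy | hy
    · have : ((List.range (j : ℕ)).map (simpleTransposition (n + 1))).prod y = 0 := by
        ext; rw [hr, hy]; simp
      rw [this, h0, hy, hσ]
    · obtain ⟨x, rfl⟩ := Fin.exists_succAbove_eq hy
      have : ((List.range (j : ℕ)).map (simpleTransposition (n + 1))).prod (j.succAbove x)
          = x.succ := by
        ext; rw [hr]
        simp only [Fin.succAbove, Fin.lt_def, Fin.val_succ, Fin.val_castSucc]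
        split_ifs <;> simp_all <;> omega
      rw [this, hs, removeAt_spec, hσ, Fin.zero_succAbove]

theorem length_reducedWord_mul (n i : ℕ) (hi : i + 1 < n) (σ : Equiv.Perm (Fin n)) :
    (reducedWord n (σ * simpleTransposition n i)).length ≤ (reducedWord n σ).length + 1 := by
  induction n generalizing i with
  | zero => omega
  | succ n ih =>
    set j := σ.symm 0 with hj
    set s := simpleTransposition (n + 1) i with hs
    have hσ : σ j = 0 := by simp [hj]
    have hss : ∀ x, s (s x) = x := fun x => by
      ext; rw [hs, simpleTransposition_val _ _ hi, simpleTransposition_val _ _ hi]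
      split_ifs <;> omega
    have hj' : (σ * s).symm 0 = s j := by
      rw [Equiv.symm_apply_eq, Equiv.Perm.mul_apply, hss, hσ]
    have hσ' : (σ * s) (s j) = 0 := by rw [Equiv.Perm.mul_apply, hss, hσ]
    have hjv : (s j : ℕ) = _ := simpleTransposition_val (n + 1) i hi j
    simp only [reducedWord, hj', ← hj, List.length_append, List.length_map, List.length_range]
    by_cases hc : (j : ℕ) = i ∨ (j : ℕ) = i + 1
    · have : removeAt (σ * s) (s j) = removeAt σ j := by
        refine removeAt_unique _ _ _ fun x => ?_
        rw [hσ', ← hσ, ← removeAt_spec, Equiv.Perm.mul_apply]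
        congr 1
        ext
        rw [hs, simpleTransposition_val _ _ hi, ← hs]
        simp only [Fin.succAbove, Fin.lt_def, Fin.val_castSucc]
        rw [hjv]
        split_ifs <;> simp_all <;> omega
      rw [this, hjv]
      split_ifs <;> omega
    · have hsj : s j = j := by ext; rw [hjv]; split_ifs <;> omega
      have hjn := j.isLt
      obtain ⟨m, hm, hmi⟩ : ∃ m, m + 1 < n ∧
          ((i + 1 < j ∧ m = i) ∨ ((j : ℕ) < i ∧ m + 1 = i)) := by
        rcases lt_or_ge (i + 1) (j : ℕ) with h | h
        · exact ⟨i, by omega, Or.inl ⟨h, rfl⟩⟩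
        · exact ⟨i - 1, by omega, Or.inr ⟨by omega, by omega⟩⟩
      have : removeAt (σ * s) (s j) = removeAt σ j * simpleTransposition n m := by
        refine removeAt_unique _ _ _ fun x => ?_
        rw [hσ', ← hσ, Equiv.Perm.mul_apply, Equiv.Perm.mul_apply, ← removeAt_spec, hsj]
        congr 1
        ext
        rw [hs, simpleTransposition_val _ _ hi]
        simp only [Fin.succAbove, Fin.lt_def, Fin.val_castSucc, apply_ite Fin.val, Fin.val_succ,
          simpleTransposition_val _ _ hm]
        split_ifs <;> omega
      rw [this, hsj]
      have := ih m hm (removeAt σ j)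
      omega

theorem length_reducedWord_le (n : ℕ) (w : List ℕ) :
    (reducedWord n ((w.map (simpleTransposition n)).prod)).length ≤ w.length := by
  induction w using List.reverseRecOn with
  | nil =>
    simp only [List.map_nil, List.prod_nil, List.length_nil, Nat.le_zero]
    induction n with
    | zero => rfl
    | succ n ih =>
      have : removeAt (1 : Equiv.Perm (Fin (n + 1))) 0 = 1 :=
        removeAt_unique _ _ _ fun x => by simp
      have h0 : (1 : Equiv.Perm (Fin (n + 1))).symm 0 = 0 := rfl
      simp [reducedWord, h0, this, ih]
  | append_singleton w i ih =>
    simp only [List.map_append, List.prod_append, List.map_cons, List.map_nil,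
      List.prod_singleton, List.length_append, List.length_singleton]
    by_cases hi : i + 1 < n
    · exact (length_reducedWord_mul n i hi _).trans (by omega)
    · rw [simpleTransposition, dif_neg hi, mul_one]
      omega

theorem isReducedWord_reducedWord (n : ℕ) (σ : Equiv.Perm (Fin n)) :
    IsReducedWord σ (reducedWord n σ) :=
  ⟨reducedWord_lt n σ, prod_reducedWord n σ, fun w' h => h ▸ length_reducedWord_le n w'⟩

/-! ### Quantum symmetrizers and Nichols algebras -/

section NicholsAlgebra

variable {k V : Type*} [Field k] [AddCommGroup V] [Module k V]

variable (k V) in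
/-- The identification `V ⊗ V = T²(V)`. -/
noncomputable def pairEquiv : V ⊗[k] V ≃ₗ[k] ⨂[k]^2 V :=
  let e : V ≃ₗ[k] ⨂[k]^1 V :=
    (PiTensorProduct.subsingletonEquiv (s := fun _ : Fin 1 => V) (0 : Fin 1)).symm
  TensorProduct.congr e e ≪≫ₗ
    (TensorPower.mulEquiv : ⨂[k]^1 V ⊗[k] ⨂[k]^1 V ≃ₗ[k] ⨂[k]^(1 + 1) V)

/-- `id^{⊗ i} ⊗ f ⊗ id^{⊗ j}` on `T^{i+2+j}(V) = Tⁱ(V) ⊗ T²(V) ⊗ Tʲ(V)`, for an endomorphism `f` of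
`V ⊗ V = T²(V)`. -/
noncomputable def applyAt (f : Module.End k (V ⊗[k] V)) (i j : ℕ) :
    Module.End k (⨂[k]^(i + 2 + j) V) :=
  let g : Module.End k (⨂[k]^(i + 2) V) :=
    TensorPower.mulEquiv.conj (((pairEquiv k V).conj f).lTensor (⨂[k]^i V))
  TensorPower.mulEquiv.conj (g.rTensor (⨂[k]^j V))

/-- The image `c_i` of the `i`-th standard generator of the braid group `𝔹_n` in `GL(Tⁿ(V))`: the
braiding acting on the tensor factors `i` and `i + 1` (factors are counted from `0`; the value is
the identity if there are no such factors, a case that never occurs below). -/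
noncomputable def braidGenerator (c : Braiding k V) (n i : ℕ) : Module.End k (⨂[k]^n V) :=
  if h : i + 2 + (n - (i + 2)) = n then
    (TensorPower.cast k V h).conj (applyAt c.toMap i (n - (i + 2)))
  else 1

/-- The quantum symmetrizer `Q_n = ∑_{σ ∈ S_n} ρ_n(M(σ))` in `End(Tⁿ(V))`. Here `M` is the Matsumoto
section: `ρ_n(M(σ)) = c_{i₁} ⋯ c_{i_l}` for a reduced word `s_{i₁} ⋯ s_{i_l}` of `σ`, and by the
braid equation it does not matter which one. -/
noncomputable def quantumSymmetrizer (c : Braiding k V) (n : ℕ) : Module.End k (⨂[k]^n V) :=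
  ∑ σ : Equiv.Perm (Fin n), ((reducedWord n σ).map (braidGenerator c n)).prod

/-- `J_n(V)`, the kernel of the `n`-th quantum symmetrizer, as a subspace of `T(V)`: the relations
of degree `n` of the Nichols algebra. -/
noncomputable def relations (c : Braiding k V) (n : ℕ) : Submodule k (TensorAlgebra k V) :=
  (LinearMap.ker (quantumSymmetrizer c n)).map TensorPower.toTensorAlgebra

/-- `J(V) = ⨁_{n ≥ 2} J_n(V)`, the space of all relations of the Nichols algebra. -/
noncomputable def definingIdeal (c : Braiding k V) : Submodule k (TensorAlgebra k V) :=
  ⨆ n ≥ 2, relations c n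

/-- The Nichols algebra `𝔅(V) = T(V) / J(V)`. -/
abbrev NicholsAlgebra (c : Braiding k V) : Type _ :=
  RingQuot fun x y : TensorAlgebra k V => x ∈ definingIdeal c ∧ y = 0

/-- The image in `𝔅(V)` of a vector `v` of `V`. -/
noncomputable def NicholsAlgebra.ι (c : Braiding k V) (v : V) : NicholsAlgebra c :=
  RingQuot.mkAlgHom k _ (TensorAlgebra.ι k v)

end NicholsAlgebra

/-! ### Gelfand-Kirillov dimension -/

/-- The Gelfand-Kirillov dimension of a (nonzero) `k`-algebra `A`: the supremum over all
finite-dimensional subspaces `W` of `A` of `limsup_n log dim(k + W + ⋯ + Wⁿ) / log n`. -/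
noncomputable def gkDim (k A : Type*) [Field k] [Ring A] [Algebra k A] : EReal :=
  ⨆ W : {W : Submodule k A // W.FG},
    Filter.limsup
      (fun n : ℕ =>
        ((Real.log (Module.finrank k ↥((1 ⊔ W.1) ^ n)) / Real.log n : ℝ) : EReal))
      Filter.atTop

/-! ### Braidings given by `R`-matrices of rank three -/

section RankThree

variable {k : Type*} [Field k]

/-- The basis vectors `x_1, x_2, x_3` of `V = k³`, here numbered `0, 1, 2`. -/
def x (k : Type*) [Field k] (i : Fin 3) : Fin 3 → k := Pi.single i 1

/-- The linear map `c(x_i ⊗ x_j) = ∑_{k,l} r^{ij}_{kl} x_k ⊗ x_l` attached to a `9 × 9` matrix with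
columns `R^{11}, R^{21}, R^{31}, R^{12}, R^{22}, R^{32}, R^{13}, R^{23}, R^{33}`, where the entries
of the column `R^{ij}` are
`r^{ij}_{11}, r^{ij}_{12}, r^{ij}_{13}, r^{ij}_{21}, …, r^{ij}_{33}` from top to bottom. -/
noncomputable def mapOfMatrix (R : Matrix (Fin 9) (Fin 9) k) :
    (Fin 3 → k) ⊗[k] (Fin 3 → k) →ₗ[k] (Fin 3 → k) ⊗[k] (Fin 3 → k) :=
  ((Pi.basisFun k (Fin 3)).tensorProduct (Pi.basisFun k (Fin 3))).constr k fun ij =>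
    ∑ m : Fin 3, ∑ l : Fin 3,
      R (finProdFinEquiv (m, l)) (finProdFinEquiv (ij.2, ij.1)) • (x k m ⊗ₜ[k] x k l)

/-- The `R`-matrix `ℜ_{1,3}`. -/
def R13 (a b p q t : k) : Matrix (Fin 9) (Fin 9) k :=
  !![t, 0, t*a,  0, 0, 0,    -(t*a), 0,      -(t*a*b);
     0, t, 0,    0, 0, 0,    0,      -(t*b), -(t*p);
     0, 0, t,    0, 0, 0,    0,      0,      -(t*b);
     0, 0, 0,    t, 0, t*b,  0,      0,      t*p;
     0, 0, 0,    0, t, 0,    0,      0,      t*q;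
     0, 0, 0,    0, 0, t,    0,      0,      0;
     0, 0, 0,    0, 0, 0,    t,      0,      t*b;
     0, 0, 0,    0, 0, 0,    0,      t,      0;
     0, 0, 0,    0, 0, 0,    0,      0,      t]

theorem mapOfMatrix_tmul (R : Matrix (Fin 9) (Fin 9) k) (i j : Fin 3) :
    mapOfMatrix R (x k i ⊗ₜ x k j) = ∑ m : Fin 3, ∑ l : Fin 3,
      R (finProdFinEquiv (m, l)) (finProdFinEquiv (j, i)) • (x k m ⊗ₜ[k] x k l) := by
  have := ((Pi.basisFun k (Fin 3)).tensorProduct (Pi.basisFun k (Fin 3))).constr_basis k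
    (fun ij => ∑ m : Fin 3, ∑ l : Fin 3,
      R (finProdFinEquiv (m, l)) (finProdFinEquiv (ij.2, ij.1)) • (x k m ⊗ₜ[k] x k l)) (i, j)
  rwa [Module.Basis.tensorProduct_apply, Pi.basisFun_apply, Pi.basisFun_apply] at this

theorem mapOfMatrix_R13 (a b p q t : k) :
    let c := mapOfMatrix (R13 a b p q t)
    let e := x k
    c (e 0 ⊗ₜ e 0) = t • e 0 ⊗ₜ e 0 ∧
    c (e 1 ⊗ₜ e 0) = t • e 0 ⊗ₜ e 1 ∧
    c (e 2 ⊗ₜ e 0) = t • e 0 ⊗ₜ e 2 + (t * a) • e 0 ⊗ₜ e 0 ∧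
    c (e 0 ⊗ₜ e 1) = t • e 1 ⊗ₜ e 0 ∧
    c (e 1 ⊗ₜ e 1) = t • e 1 ⊗ₜ e 1 ∧
    c (e 2 ⊗ₜ e 1) = t • e 1 ⊗ₜ e 2 + (t * b) • e 1 ⊗ₜ e 0 ∧
    c (e 0 ⊗ₜ e 2) = t • e 2 ⊗ₜ e 0 - (t * a) • e 0 ⊗ₜ e 0 ∧
    c (e 1 ⊗ₜ e 2) = t • e 2 ⊗ₜ e 1 - (t * b) • e 0 ⊗ₜ e 1 ∧
    c (e 2 ⊗ₜ e 2) = t • e 2 ⊗ₜ e 2 + (t * b) • e 2 ⊗ₜ e 0 + (t * q) • e 1 ⊗ₜ e 1 +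
      (t * p) • e 1 ⊗ₜ e 0 - (t * b) • e 0 ⊗ₜ e 2 - (t * p) • e 0 ⊗ₜ e 1 -
      (t * a * b) • e 0 ⊗ₜ e 0 := by
  have h : ∀ m l : Fin 3, (finProdFinEquiv (m, l) : Fin 9) =
      ⟨l + 3 * m, by omega⟩ := fun m l => rfl
  refine ⟨?_, ?_, ?_, ?_, ?_, ?_, ?_, ?_, ?_⟩ <;>
  · rw [mapOfMatrix_tmul]
    simp [Fin.sum_univ_three, h, R13]
    try module

set_option maxHeartbeats 2000000 in
theorem braid_aux {V : Type*} [AddCommGroup V] [Module k V] (a b p q t : k)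
    (c : V ⊗[k] V →ₗ[k] V ⊗[k] V) (e : Fin 3 → V)
    (h00 : c (e 0 ⊗ₜ e 0) = t • e 0 ⊗ₜ e 0)
    (h10 : c (e 1 ⊗ₜ e 0) = t • e 0 ⊗ₜ e 1)
    (h20 : c (e 2 ⊗ₜ e 0) = t • e 0 ⊗ₜ e 2 + (t * a) • e 0 ⊗ₜ e 0)
    (h01 : c (e 0 ⊗ₜ e 1) = t • e 1 ⊗ₜ e 0)
    (h11 : c (e 1 ⊗ₜ e 1) = t • e 1 ⊗ₜ e 1)
    (h21 : c (e 2 ⊗ₜ e 1) = t • e 1 ⊗ₜ e 2 + (t * b) • e 1 ⊗ₜ e 0)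
    (h02 : c (e 0 ⊗ₜ e 2) = t • e 2 ⊗ₜ e 0 - (t * a) • e 0 ⊗ₜ e 0)
    (h12 : c (e 1 ⊗ₜ e 2) = t • e 2 ⊗ₜ e 1 - (t * b) • e 0 ⊗ₜ e 1)
    (h22 : c (e 2 ⊗ₜ e 2) = t • e 2 ⊗ₜ e 2 + (t * b) • e 2 ⊗ₜ e 0 + (t * q) • e 1 ⊗ₜ e 1 +
      (t * p) • e 1 ⊗ₜ e 0 - (t * b) • e 0 ⊗ₜ e 2 - (t * p) • e 0 ⊗ₜ e 1 -
      (t * a * b) • e 0 ⊗ₜ e 0)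
    (c₁ c₂ : V ⊗[k] (V ⊗[k] V) →ₗ[k] V ⊗[k] (V ⊗[k] V))
    (h1 : ∀ u v w : V, c₁ (u ⊗ₜ (v ⊗ₜ w)) = TensorProduct.assoc k _ _ _ (c (u ⊗ₜ v) ⊗ₜ w))
    (h2 : ∀ u v w : V, c₂ (u ⊗ₜ (v ⊗ₜ w)) = u ⊗ₜ c (v ⊗ₜ w)) (i j l : Fin 3) :
    c₁ (c₂ (c₁ (e i ⊗ₜ (e j ⊗ₜ e l)))) = c₂ (c₁ (c₂ (e i ⊗ₜ (e j ⊗ₜ e l)))) := by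
  fin_cases i <;> fin_cases j <;> fin_cases l <;>
  · simp only [Fin.zero_eta, Fin.mk_one, Fin.reduceFinMk, h1, h2, h00, h10, h20, h01, h11, h21,
      h02, h12, h22, TensorProduct.add_tmul, TensorProduct.tmul_add, TensorProduct.sub_tmul,
      TensorProduct.tmul_sub, map_add, map_sub, map_smul, TensorProduct.tmul_smul,
      ← TensorProduct.smul_tmul', TensorProduct.assoc_tmul]
    try module

/-- The braiding of `V = k³` associated to `ℜ_{1,3}`. -/
noncomputable def braiding13 (a b p q t : k) (ht : t ≠ 0) : Braiding k (Fin 3 → k) where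
  toMap := mapOfMatrix (R13 a b p q t)
  bijective := by
    obtain ⟨h00, h10, h20, h01, h11, h21, h02, h12, h22⟩ := mapOfMatrix_R13 a b p q t
    set c := mapOfMatrix (R13 a b p q t)
    set r := LinearMap.range c with hr
    have key : ∀ u w, c u = t • w → w ∈ r := fun u w h =>
      ⟨t⁻¹ • u, by rw [map_smul, h, smul_smul, inv_mul_cancel₀ ht, one_smul]⟩
    have hc : ∀ u, c u ∈ r := fun u => ⟨u, rfl⟩
    have k00 := key _ _ h00
    have k01 := key _ _ h10
    have k10 := key _ _ h01
    have k11 := key _ _ h11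
    have key' : ∀ w, t • w ∈ r → w ∈ r := fun w h => by
      simpa [smul_smul, inv_mul_cancel₀ ht] using r.smul_mem t⁻¹ h
    have k02 : x k 0 ⊗ₜ[k] x k 2 ∈ r := key' _ <| by
      have := r.sub_mem (hc (x k 2 ⊗ₜ x k 0)) (r.smul_mem (t * a) k00)
      rw [h20] at this; convert this using 1; module
    have k12 : x k 1 ⊗ₜ[k] x k 2 ∈ r := key' _ <| by
      have := r.sub_mem (hc (x k 2 ⊗ₜ x k 1)) (r.smul_mem (t * b) k10)
      rw [h21] at this; convert this using 1; module
    have k20 : x k 2 ⊗ₜ[k] x k 0 ∈ r := key' _ <| by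
      have := r.add_mem (hc (x k 0 ⊗ₜ x k 2)) (r.smul_mem (t * a) k00)
      rw [h02] at this; convert this using 1; module
    have k21 : x k 2 ⊗ₜ[k] x k 1 ∈ r := key' _ <| by
      have := r.add_mem (hc (x k 1 ⊗ₜ x k 2)) (r.smul_mem (t * b) k01)
      rw [h12] at this; convert this using 1; module
    have k22 : x k 2 ⊗ₜ[k] x k 2 ∈ r := key' _ <| by
      have := r.add_mem (hc (x k 2 ⊗ₜ x k 2)) (r.add_mem (r.smul_mem (-(t * b)) k20)
        (r.add_mem (r.smul_mem (-(t * q)) k11) (r.add_mem (r.smul_mem (-(t * p)) k10)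
        (r.add_mem (r.smul_mem (t * b) k02) (r.add_mem (r.smul_mem (t * p) k01)
        (r.smul_mem (t * a * b) k00))))))
      rw [h22] at this; convert this using 1; module
    have hs : Function.Surjective c := by
      rw [← LinearMap.range_eq_top, ← hr, eq_top_iff,
        ← ((Pi.basisFun k (Fin 3)).tensorProduct (Pi.basisFun k (Fin 3))).span_eq,
        Submodule.span_le]
      rintro _ ⟨⟨i, j⟩, rfl⟩
      rw [Module.Basis.tensorProduct_apply, Pi.basisFun_apply, Pi.basisFun_apply]
      change x k i ⊗ₜ[k] x k j ∈ r
      fin_cases i <;> fin_cases j <;> assumption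
    exact ⟨LinearMap.injective_iff_surjective.mpr hs, hs⟩
  braid_eq := by
    intro c₁ c₂
    obtain ⟨h00, h10, h20, h01, h11, h21, h02, h12, h22⟩ := mapOfMatrix_R13 a b p q t
    refine ((Pi.basisFun k (Fin 3)).tensorProduct
      ((Pi.basisFun k (Fin 3)).tensorProduct (Pi.basisFun k (Fin 3)))).ext ?_
    rintro ⟨i, j, l⟩
    have h1 : ∀ u v w : Fin 3 → k, c₁ (u ⊗ₜ (v ⊗ₜ w)) = TensorProduct.assoc k _ _ _
      (mapOfMatrix (R13 a b p q t) (u ⊗ₜ v) ⊗ₜ w) := fun u v w => rfl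
    have h2 : ∀ u v w : Fin 3 → k, c₂ (u ⊗ₜ (v ⊗ₜ w)) =
      u ⊗ₜ mapOfMatrix (R13 a b p q t) (v ⊗ₜ w) := fun u v w => rfl
    simp only [Module.Basis.tensorProduct_apply, Pi.basisFun_apply, Module.End.mul_apply]
    exact braid_aux a b p q t _ (x k) h00 h10 h20 h01 h11 h21 h02 h12 h22 c₁ c₂ h1 h2 i j l


/-- The generators `x_1, x_2, x_3` of the tensor algebra `T(V)`. -/
def X (k : Type*) [Field k] (i : Fin 3) : TensorAlgebra k (Fin 3 → k) := TensorAlgebra.ι k (x k i)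

/-- The monomial `x_1^{a_1} x_2^{a_2} x_3^{a_3}` in `𝔅(V)`. -/
noncomputable def monomial (c : Braiding k (Fin 3 → k)) (e : ℕ × ℕ × ℕ) : NicholsAlgebra c :=
  NicholsAlgebra.ι c (x k 0) ^ e.1 * NicholsAlgebra.ι c (x k 1) ^ e.2.1 *
    NicholsAlgebra.ι c (x k 2) ^ e.2.2

/-- The monomials with exponents `(a_1, a_2, a_3)` in `S` form a basis of `𝔅(V)`. -/
def IsMonomialBasis (c : Braiding k (Fin 3 → k)) (S : Set (ℕ × ℕ × ℕ)) : Prop :=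
  LinearIndependent k (fun e : S => monomial c e.1) ∧
    Submodule.span k (Set.range fun e : S => monomial c e.1) = ⊤

end RankThree

/-- The exponents of the monomials in `B_0`. -/
def B0 : Set (ℕ × ℕ × ℕ) := {e | e.1 < 2 ∧ e.2.1 < 2 ∧ e.2.2 < 2}

/-- The exponents of the monomials in `B_1`. -/
def B1 : Set (ℕ × ℕ × ℕ) := {e | e.1 < 2 ∧ e.2.1 < 2}

/-- The exponents of the monomials in `B_3`. -/
def B3 : Set (ℕ × ℕ × ℕ) := Set.univ

end Nichols

open Nichols

/-!
The skew derivations `∂_m` of `T(V)` attached to the braiding detect the defining ideal: an element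
of degree `n + 1` is in `𝒥` if and only if all of its skew derivatives are. Hence, if `R` consists
of quadratic elements, the `∂_m` descend to `A = T(V) / ⟨R⟩` and only the scalars of `A` are
annihilated by all of them, then `𝒥 = ⟨R⟩`. For the three sets `R` of relations, straightening shows
that the ordered monomials span `A`. Composites of an iterated derivative `∂_1^i ∂_2^j`, an operator
lowering the degree in `x_3`, and the augmentation are functionals triangular on these monomials;
they give both linear independence and the statement on the common kernel of the `∂_m`. The
Gelfand-Kirillov dimension is then read off from the number of monomials of degree at most `n`.
-/

namespace Nichols

/-! ### Skew derivations -/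

theorem mem_of_mul_mem {k A ι : Type*} [CommSemiring k] [Semiring A] [Algebra k A] {y : ι → A}
    (hy : Algebra.adjoin k (Set.range y) = ⊤) {N : Submodule k A} (h1 : 1 ∈ N)
    (hN : ∀ j, ∀ w ∈ N, y j * w ∈ N) (w : A) : w ∈ N := by
  have hle : Subalgebra.toSubmodule (Algebra.adjoin k (Set.range y)) ≤ N := by
    refine (Algebra.adjoin_toSubmodule_le k).2 fun v hv => ?_
    induction hv using Submonoid.closure_induction_left with
    | one => exact h1
    | mul_left u hu v _ ih =>
      obtain ⟨j, rfl⟩ := hu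
      exact hN j v ih
  exact hle (by simp [hy])

section SkewCalculus

variable {k A ι : Type*} [CommSemiring k] [Semiring A] [Algebra k A] [Fintype ι] [DecidableEq ι]

/-- Linear endomorphisms `D m` of an algebra `A` obeying the product rule of the skew derivations
of a braided vector space, where `y j` is the image in `A` of the `j`-th basis vector and `C` is
the array of structure constants of the braiding (see `Braiding.HasCoeffs`). -/
structure SkewCalculus (C : ι → ι → ι → ι → k) (y : ι → A) (D : ι → A →ₗ[k] A) : Prop where
  one : ∀ m, D m 1 = 0
  mul : ∀ m j w, D m (y j * w) = (if m = j then w else 0) +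
    ∑ i, ∑ l, C j i m l • (y l * D i w)

/-- The operator `(w, D w) ↦ (y j * w, D (y j * w))` on an element together with its skew
derivatives. A skew calculus on `A` amounts to an action of `A` in which each `y j` acts by this
operator, so relations among the `y j` have to be checked on these operators only. -/
def skewOp (C : ι → ι → ι → ι → k) (y : ι → A) (j : ι) : Module.End k (A × (ι → A)) where
  toFun f := (y j * f.1,
    fun m => (if m = j then f.1 else 0) + ∑ i, ∑ l, C j i m l • (y l * f.2 i))
  map_add' f g := by
    refine Prod.ext (mul_add _ _ _) (funext fun m => ?_)
    simp only [Prod.fst_add, Prod.snd_add, Pi.add_apply, mul_add, smul_add,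
      Finset.sum_add_distrib, ite_add_zero]
    abel
  map_smul' r f := by
    refine Prod.ext (by simp) (funext fun m => ?_)
    simp only [Prod.smul_fst, Prod.smul_snd, Pi.smul_apply, mul_smul_comm, RingHom.id_apply,
      smul_add, Finset.smul_sum, smul_comm r, smul_ite, smul_zero]

variable (k) in
/-- The `m`-th skew derivative of the element acting by an endomorphism of `A × (ι → A)`. -/
def evalOne {ι : Type*} (A : Type*) [Semiring A] [Algebra k A] (m : ι) :
    Module.End k (A × (ι → A)) →ₗ[k] A :=
  LinearMap.proj m ∘ₗ LinearMap.snd k A (ι → A) ∘ₗ LinearMap.applyₗ (1, 0)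

@[simp]
theorem evalOne_apply {ι : Type*} (m : ι) (f : Module.End k (A × (ι → A))) :
    evalOne k A m f = (f (1, 0)).2 m := rfl

theorem fst_apply_one {C : ι → ι → ι → ι → k} {y : ι → A}
    (hy : Algebra.adjoin k (Set.range y) = ⊤) {Ψ : A →ₐ[k] Module.End k (A × (ι → A))}
    (hΨ : ∀ j, Ψ (y j) = skewOp C y j) (w : A) : (Ψ w (1, 0)).1 = w := by
  let N : Submodule k A := LinearMap.eqLocus
    (LinearMap.fst k A (ι → A) ∘ₗ LinearMap.applyₗ (1, 0) ∘ₗ Ψ.toLinearMap) LinearMap.id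
  refine mem_of_mul_mem hy (N := N) (by simp [N]) (fun j v hv => ?_) w
  have hv : (Ψ v (1, 0)).1 = v := hv
  change (Ψ (y j * v) (1, 0)).1 = y j * v
  rw [map_mul, hΨ, Module.End.mul_apply]
  exact congrArg (y j * ·) hv

theorem SkewCalculus.of_algHom {C : ι → ι → ι → ι → k} {y : ι → A}
    (hy : Algebra.adjoin k (Set.range y) = ⊤) {Ψ : A →ₐ[k] Module.End k (A × (ι → A))}
    (hΨ : ∀ j, Ψ (y j) = skewOp C y j) :
    SkewCalculus C y fun m => evalOne k A m ∘ₗ Ψ.toLinearMap where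
  one m := by simp
  mul m j w := by simp [hΨ, skewOp, fst_apply_one hy hΨ w]

end SkewCalculus

section TensorAlgebra

variable {k V ι : Type*} [Field k] [AddCommGroup V] [Module k V] (e : Module.Basis ι k V)

theorem adjoin_range_ι_basis :
    Algebra.adjoin k (Set.range fun j => TensorAlgebra.ι k (e j)) = ⊤ := by
  rw [Set.range_comp', ← Algebra.adjoin_span, ← Submodule.map_span, e.span_eq, Submodule.map_top,
    LinearMap.coe_range, TensorAlgebra.adjoin_range_ι]

theorem ι_mul_induction {p : TensorAlgebra k V → Prop}
    (one : p 1) (ι_mul : ∀ j w, p w → p (TensorAlgebra.ι k (e j) * w))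
    (add : ∀ u v, p u → p v → p (u + v)) (smul : ∀ (r : k) u, p u → p (r • u)) (w) : p w :=
  let N : Submodule k (TensorAlgebra k V) :=
    { carrier := {w | p w}
      add_mem' := fun hu hv => add _ _ hu hv
      zero_mem' := by simpa using smul 0 1 one
      smul_mem' := smul }
  mem_of_mul_mem (adjoin_range_ι_basis e) (N := N) one ι_mul w

variable [Fintype ι] [DecidableEq ι]

/-- The action of the tensor algebra on `A × (ι → A)` by the operators `skewOp C y j`. -/
noncomputable def skewRep {A : Type*} [Ring A] [Algebra k A] (C : ι → ι → ι → ι → k)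
    (y : ι → A) : TensorAlgebra k V →ₐ[k] Module.End k (A × (ι → A)) :=
  TensorAlgebra.lift k (e.constr k (skewOp C y))

@[simp]
theorem skewRep_ι {A : Type*} [Ring A] [Algebra k A] (C : ι → ι → ι → ι → k)
    (y : ι → A) (j : ι) : skewRep e C y (TensorAlgebra.ι k (e j)) = skewOp C y j := by
  simp [skewRep]

/-- The skew derivations `∂_m` of the tensor algebra attached to the structure constants of a
braiding. -/
noncomputable def skewDeriv (C : ι → ι → ι → ι → k) (m : ι) :
    TensorAlgebra k V →ₗ[k] TensorAlgebra k V :=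
  evalOne k _ m ∘ₗ (skewRep e C fun j => TensorAlgebra.ι k (e j)).toLinearMap

theorem skewCalculus_skewDeriv (C : ι → ι → ι → ι → k) :
    SkewCalculus C (fun j => TensorAlgebra.ι k (e j)) (skewDeriv e C) :=
  .of_algHom (adjoin_range_ι_basis e) (skewRep_ι e C _)

theorem SkewCalculus.map_skewDeriv {A : Type*} [Ring A] [Algebra k A] {C : ι → ι → ι → ι → k}
    {π : TensorAlgebra k V →ₐ[k] A} {D : ι → A →ₗ[k] A}
    (hD : SkewCalculus C (fun j => π (TensorAlgebra.ι k (e j))) D) (m : ι)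
    (w : TensorAlgebra k V) : π (skewDeriv e C m w) = D m (π w) := by
  have h := skewCalculus_skewDeriv e C
  induction w using ι_mul_induction e generalizing m with
  | one => rw [h.one, map_one, hD.one, map_zero]
  | ι_mul j w hw => simp [h.mul, hD.mul, hw, apply_ite π]
  | add u v hu hv => simp [hu, hv]
  | smul r u hu => simp [hu]

omit [DecidableEq ι] in
theorem eq_zero_of_sum_ι_mul_eq_zero {a : ι → TensorAlgebra k V}
    (h : ∑ j, TensorAlgebra.ι k (e j) * a j = 0) (j : ι) : a j = 0 := by
  classical
  have := congrArg (skewDeriv e (fun _ _ _ _ => 0) j) h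
  simpa [(skewCalculus_skewDeriv e _).mul] using this

end TensorAlgebra

/-! ### Quantum symmetrizers inside the tensor algebra -/

section QuantumSymmetrizer

variable {k V : Type*} [Field k] [AddCommGroup V] [Module k V]

open TensorPower hiding mul_assoc one_mul mul_one cast

theorem toTensorAlgebra_eq_equivDirectSum_symm (n : ℕ) (u : ⨂[k]^n V) :
    toTensorAlgebra u =
      TensorAlgebra.equivDirectSum.symm (DirectSum.of (fun n => ⨂[k]^n V) n u) :=
  (DirectSum.toAddMonoid_of
    (fun _ => LinearMap.toAddMonoidHom TensorPower.toTensorAlgebra) _ _).symm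

theorem toTensorAlgebra_injective (n : ℕ) :
    Function.Injective (toTensorAlgebra : ⨂[k]^n V →ₗ[k] TensorAlgebra k V) := by
  intro u v huv
  simp only [toTensorAlgebra_eq_equivDirectSum_symm] at huv
  exact DirectSum.of_injective n (TensorAlgebra.equivDirectSum.symm.injective huv)

theorem homogeneous_induction {p : TensorAlgebra k V → Prop}
    (zero : p 0) (add : ∀ u v, p u → p v → p (u + v))
    (hom : ∀ n (u : ⨂[k]^n V), p (toTensorAlgebra u)) (w) : p w := by
  obtain ⟨w, rfl⟩ := (TensorAlgebra.equivDirectSum (R := k) (M := V)).symm.surjective w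
  induction w using DirectSum.induction_on with
  | zero => simpa using zero
  | add u v hu hv => rw [map_add]; exact add _ _ hu hv
  | of n u => exact toTensorAlgebra_eq_equivDirectSum_symm n u ▸ hom n u

@[simp]
theorem toTensorAlgebra_cast {n m : ℕ} (h : n = m) (u : ⨂[k]^n V) :
    toTensorAlgebra (TensorPower.cast k V h u) = toTensorAlgebra u := by
  subst h; simp

@[simp]
theorem toTensorAlgebra_mulEquiv {i j : ℕ} (a : ⨂[k]^i V) (b : ⨂[k]^j V) :
    toTensorAlgebra (mulEquiv (a ⊗ₜ[k] b)) = toTensorAlgebra a * toTensorAlgebra b :=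
  toTensorAlgebra_gMul a b

theorem toTensorAlgebra_zero (u : ⨂[k]^0 V) :
    ∃ r : k, toTensorAlgebra u = algebraMap k (TensorAlgebra k V) r := by
  obtain ⟨r, rfl⟩ := (algebraMap₀ (R := k) (M := V)).surjective u
  exact ⟨r, by rw [algebraMap₀_eq_smul_one, map_smul, toTensorAlgebra_gOne,
    Algebra.algebraMap_eq_smul_one]⟩

variable (k V) in
/-- The multiplication `V ⊗ V → T(V)`, whose image consists of the quadratic elements. -/
noncomputable def pairMul : V ⊗[k] V →ₗ[k] TensorAlgebra k V :=
  LinearMap.mul' k _ ∘ₗ TensorProduct.map (TensorAlgebra.ι k) (TensorAlgebra.ι k)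

@[simp]
theorem pairMul_tmul (v w : V) :
    pairMul k V (v ⊗ₜ w) = TensorAlgebra.ι k v * TensorAlgebra.ι k w := by
  simp [pairMul]

@[simp]
theorem toTensorAlgebra_pairEquiv (z : V ⊗[k] V) :
    toTensorAlgebra (pairEquiv k V z) = pairMul k V z := by
  induction z using TensorProduct.induction_on with
  | zero => simp
  | add z w hz hw => simp [hz, hw]
  | tmul v w =>
    simp only [pairEquiv, LinearEquiv.trans_apply, TensorProduct.congr_tmul, pairMul_tmul]
    refine (toTensorAlgebra_mulEquiv _ _).trans ?_
    simp [TensorAlgebra.tprod_apply]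

/-- Prepending a vector to a tensor: the multiplication `V ⊗ Tⁿ(V) → Tⁿ⁺¹(V)`. -/
noncomputable def consTensor (n : ℕ) : V →ₗ[k] ⨂[k]^n V →ₗ[k] ⨂[k]^(n + 1) V :=
  (TensorProduct.mk k _ _).compr₂
    ((TensorPower.cast k V (add_comm 1 n)).toLinearMap ∘ₗ mulEquiv.toLinearMap) ∘ₗ
    (PiTensorProduct.subsingletonEquiv (s := fun _ : Fin 1 => V) 0).symm.toLinearMap

@[simp]
theorem toTensorAlgebra_consTensor (n : ℕ) (v : V) (u : ⨂[k]^n V) :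
    toTensorAlgebra (consTensor n v u) = TensorAlgebra.ι k v * toTensorAlgebra u := by
  simp [consTensor, TensorAlgebra.tprod_apply]

theorem tprod_succ (n : ℕ) (f : Fin (n + 1) → V) :
    PiTensorProduct.tprod k f = consTensor n (f 0) (PiTensorProduct.tprod k fun i => f i.succ) := by
  apply toTensorAlgebra_injective
  simp [TensorAlgebra.tprod_apply, List.ofFn_succ]

theorem consTensor_induction {ι : Type*} (e : Module.Basis ι k V) {n : ℕ}
    {p : ⨂[k]^(n + 1) V → Prop} (zero : p 0) (cons : ∀ j w, p (consTensor n (e j) w))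
    (add : ∀ u v, p u → p v → p (u + v)) (smul : ∀ (r : k) u, p u → p (r • u)) (u) : p u := by
  let N : Submodule k (⨂[k]^(n + 1) V) :=
    { carrier := {w | p w}
      add_mem' := fun hu hv => add _ _ hu hv
      zero_mem' := zero
      smul_mem' := smul }
  have hcons (v : V) (w : ⨂[k]^n V) : consTensor n v w ∈ N := by
    have : (⊤ : Submodule k V) ≤ N.comap ((consTensor n).flip w) := by
      rw [← e.span_eq, Submodule.span_le]
      rintro _ ⟨j, rfl⟩
      exact cons j w
    exact this (Submodule.mem_top (x := v))
  have htop : (⊤ : Submodule k (⨂[k]^(n + 1) V)) ≤ N := by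
    rw [← PiTensorProduct.span_tprod_eq_top, Submodule.span_le]
    rintro _ ⟨f, rfl⟩
    rw [tprod_succ]
    exact hcons _ _
  exact htop trivial

theorem mul_pairMul_mul_induction {n i j : ℕ} (h : i + 2 + j = n) {p : ⨂[k]^n V → Prop}
    (zero : p 0) (add : ∀ u v, p u → p v → p (u + v))
    (mul : ∀ (u : ⨂[k]^n V) (a : ⨂[k]^i V) z (b : ⨂[k]^j V),
      toTensorAlgebra u = toTensorAlgebra a * pairMul k V z * toTensorAlgebra b → p u)
    (u) : p u := by
  subst h
  obtain ⟨w, rfl⟩ := (mulEquiv (R := k) (M := V) (n := i + 2) (m := j)).surjective u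
  induction w using TensorProduct.induction_on with
  | zero => simpa using zero
  | add u v hu hv => rw [map_add]; exact add _ _ hu hv
  | tmul u b =>
    obtain ⟨w, rfl⟩ := (mulEquiv (R := k) (M := V) (n := i) (m := 2)).surjective u
    induction w using TensorProduct.induction_on with
    | zero => simpa using zero
    | add u v hu hv => rw [map_add, TensorProduct.add_tmul, map_add]; exact add _ _ hu hv
    | tmul a z =>
      obtain ⟨z, rfl⟩ := (pairEquiv k V).surjective z
      exact mul _ a z b (by simp)

theorem toTensorAlgebra_braidGenerator (c : Braiding k V) {n i j : ℕ} (h : i + 2 + j = n)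
    (u : ⨂[k]^n V) (a : ⨂[k]^i V) (z : V ⊗[k] V) (b : ⨂[k]^j V)
    (hu : toTensorAlgebra u = toTensorAlgebra a * pairMul k V z * toTensorAlgebra b) :
    toTensorAlgebra (braidGenerator c n i u) =
      toTensorAlgebra a * pairMul k V (c.toMap z) * toTensorAlgebra b := by
  subst h
  obtain rfl : u = mulEquiv (mulEquiv (a ⊗ₜ pairEquiv k V z) ⊗ₜ b) := by
    apply toTensorAlgebra_injective
    simp [hu]
  have key : ∀ (l : ℕ) (h : i + 2 + l = i + 2 + j),
      toTensorAlgebra ((TensorPower.cast k V h).conj (applyAt c.toMap i l)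
        (mulEquiv (mulEquiv (a ⊗ₜ pairEquiv k V z) ⊗ₜ b))) =
      toTensorAlgebra a * pairMul k V (c.toMap z) * toTensorAlgebra b := by
    intro l h
    obtain rfl : l = j := by omega
    simp [applyAt, LinearEquiv.conj_apply]
  rw [braidGenerator, dif_pos (by omega)]
  exact key _ _

theorem toTensorAlgebra_braidGenerator_zero (c : Braiding k V) {n : ℕ} (v w : V) (u : ⨂[k]^n V) :
    toTensorAlgebra (braidGenerator c (n + 2) 0 (consTensor (n + 1) v (consTensor n w u))) =
      pairMul k V (c.toMap (v ⊗ₜ w)) * toTensorAlgebra u := by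
  rw [toTensorAlgebra_braidGenerator c (i := 0) (j := n) (by omega) _
    (algebraMap₀ 1) (v ⊗ₜ w) u (by simp [algebraMap₀_one, mul_assoc])]
  simp [algebraMap₀_one]

theorem braidGenerator_succ_consTensor (c : Braiding k V) {n i : ℕ} (hi : i + 1 < n) (v : V)
    (u : ⨂[k]^n V) :
    braidGenerator c (n + 1) (i + 1) (consTensor n v u) =
      consTensor n v (braidGenerator c n i u) := by
  obtain ⟨j, hj⟩ : ∃ j, i + 2 + j = n := ⟨n - (i + 2), by omega⟩
  induction u using mul_pairMul_mul_induction hj with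
  | zero => simp
  | add u w hu hw => simp [hu, hw]
  | mul u a z b h =>
    apply toTensorAlgebra_injective
    rw [toTensorAlgebra_consTensor, toTensorAlgebra_braidGenerator c hj u a z b h,
      toTensorAlgebra_braidGenerator c (j := j) (by omega) _ (consTensor i v a) z b (by
        simp [h, mul_assoc])]
    simp [mul_assoc]

theorem prod_braidGenerator_succ_consTensor (c : Braiding k V) {n : ℕ} (v : V) {w : List ℕ}
    (hw : ∀ i ∈ w, i + 1 < n) (u : ⨂[k]^n V) :
    ((w.map Nat.succ).map (braidGenerator c (n + 1))).prod (consTensor n v u) =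
      consTensor n v ((w.map (braidGenerator c n)).prod u) := by
  induction w with
  | nil => simp
  | cons i w ih =>
    simp only [List.map_cons, List.prod_cons, Module.End.mul_apply]
    rw [ih fun i hi => hw i (List.mem_cons_of_mem _ hi)]
    exact braidGenerator_succ_consTensor c (hw i List.mem_cons_self) v _

/-- The sum `1 + c_0 + c_0 c_1 + ⋯ + c_0 ⋯ c_{n-2}` over the shuffles of one factor to the left. -/
noncomputable def shuffleSum (c : Braiding k V) (n : ℕ) : Module.End k (⨂[k]^n V) :=
  ∑ j ∈ Finset.range n, ((List.range j).map (braidGenerator c n)).prod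

theorem shuffleSum_consTensor (c : Braiding k V) (n : ℕ) (v : V) (u : ⨂[k]^n V) :
    shuffleSum c (n + 1) (consTensor n v u) = consTensor n v u +
      braidGenerator c (n + 1) 0 (consTensor n v (shuffleSum c n u)) := by
  rw [shuffleSum, Finset.sum_range_succ', LinearMap.add_apply, add_comm (consTensor n v u),
    shuffleSum, LinearMap.sum_apply, LinearMap.sum_apply, map_sum, map_sum]
  refine congrArg (· + consTensor n v u) (Finset.sum_congr rfl fun j hj => ?_)
  rw [List.range_succ_eq_map, List.map_cons, List.prod_cons, Module.End.mul_apply,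
    prod_braidGenerator_succ_consTensor]
  intro i hi
  simp only [List.mem_range, Finset.mem_range] at hi hj
  omega

theorem removeAt_bijective (n : ℕ) :
    Function.Bijective fun σ : Equiv.Perm (Fin (n + 1)) =>
      (σ.symm 0, removeAt σ (σ.symm 0)) := by
  rw [Fintype.bijective_iff_injective_and_card]
  refine ⟨fun σ τ h => ?_, by simp [Fintype.card_perm, Nat.factorial_succ]⟩
  simp only [Prod.mk.injEq] at h
  rw [← prod_reducedWord _ σ, ← prod_reducedWord _ τ, reducedWord, reducedWord, h.2, h.1]

theorem quantumSymmetrizer_succ (c : Braiding k V) (n : ℕ) :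
    quantumSymmetrizer c (n + 1) = (∑ σ : Equiv.Perm (Fin n),
      (((reducedWord n σ).map Nat.succ).map (braidGenerator c (n + 1))).prod) *
        shuffleSum c (n + 1) := by
  rw [shuffleSum, ← Fin.sum_univ_eq_sum_range
    (fun j => ((List.range j).map (braidGenerator c (n + 1))).prod), Finset.sum_mul_sum,
    Finset.sum_comm, ← Fintype.sum_prod_type', ← (removeAt_bijective n).sum_comp,
    quantumSymmetrizer]
  simp [reducedWord]

theorem quantumSymmetrizer_succ_of_shuffleSum {ι : Type*} [Fintype ι] (c : Braiding k V) {n : ℕ}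
    {e : ι → V} {u : ⨂[k]^(n + 1) V} {w : ι → ⨂[k]^n V}
    (h : shuffleSum c (n + 1) u = ∑ m, consTensor n (e m) (w m)) :
    quantumSymmetrizer c (n + 1) u = ∑ m, consTensor n (e m) (quantumSymmetrizer c n (w m)) := by
  rw [quantumSymmetrizer_succ, Module.End.mul_apply, h, map_sum]
  refine Finset.sum_congr rfl fun m _ => ?_
  rw [LinearMap.sum_apply, quantumSymmetrizer, LinearMap.sum_apply, map_sum]
  exact Finset.sum_congr rfl fun σ _ =>
    prod_braidGenerator_succ_consTensor c _ (reducedWord_lt n σ) _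

end QuantumSymmetrizer

section Relations

variable {k V : Type*} [Field k] [AddCommGroup V] [Module k V]

open TensorPower hiding mul_assoc one_mul mul_one cast

theorem mem_relations (c : Braiding k V) {n : ℕ} (u : ⨂[k]^n V) :
    toTensorAlgebra u ∈ relations c n ↔ quantumSymmetrizer c n u = 0 := by
  rw [relations, Submodule.mem_map]
  exact ⟨fun ⟨v, hv, h⟩ => toTensorAlgebra_injective n h ▸ hv, fun h => ⟨u, h, rfl⟩⟩

@[simp]
theorem relations_zero (c : Braiding k V) : relations c 0 = ⊥ := by
  have : quantumSymmetrizer c 0 = 1 := by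
    rw [quantumSymmetrizer, Fintype.sum_unique]
    rfl
  rw [relations, this, Module.End.one_eq_id, LinearMap.ker_id, Submodule.map_bot]

@[simp]
theorem relations_one (c : Braiding k V) : relations c 1 = ⊥ := by
  have : quantumSymmetrizer c 1 = 1 := by
    rw [quantumSymmetrizer, Fintype.sum_unique]
    simp [reducedWord]
  rw [relations, this, Module.End.one_eq_id, LinearMap.ker_id, Submodule.map_bot]

variable {ι : Type*} [Fintype ι]

/-- `C` is the array of structure constants of the braiding `c` in the basis `e`:
`c (e_i ⊗ e_j) = ∑ C_{ij}^{ml} e_m ⊗ e_l`. -/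
def Braiding.HasCoeffs (c : Braiding k V) (e : Module.Basis ι k V) (C : ι → ι → ι → ι → k) :
    Prop :=
  ∀ i j, c.toMap (e i ⊗ₜ e j) = ∑ m, ∑ l, C i j m l • (e m ⊗ₜ[k] e l)

variable [DecidableEq ι] {c : Braiding k V} {e : Module.Basis ι k V} {C : ι → ι → ι → ι → k}

variable (e C) in
theorem skewDeriv_mem_range {n : ℕ} (u : ⨂[k]^(n + 1) V) (m : ι) :
    skewDeriv e C m (toTensorAlgebra u) ∈
      LinearMap.range (toTensorAlgebra : ⨂[k]^n V →ₗ[k] TensorAlgebra k V) := by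
  have hD := skewCalculus_skewDeriv e C
  induction u using consTensor_induction e generalizing m with
  | zero => simp
  | add u v hu hv => rw [map_add, map_add]; exact add_mem (hu m) (hv m)
  | smul r u hu => rw [map_smul, map_smul]; exact Submodule.smul_mem _ r (hu m)
  | cons j u =>
    rw [toTensorAlgebra_consTensor, hD.mul]
    refine add_mem ?_ (sum_mem fun i _ => sum_mem fun l _ => Submodule.smul_mem _ _ ?_)
    · split_ifs
      exacts [⟨u, rfl⟩, zero_mem _]
    · cases n with
      | zero =>
        obtain ⟨r, hr⟩ := toTensorAlgebra_zero u
        simp [hr, Algebra.algebraMap_eq_smul_one, hD.one]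
      | succ n =>
        obtain ⟨w, hw⟩ := skewDeriv_mem_range u i
        exact ⟨consTensor n (e l) w, by rw [toTensorAlgebra_consTensor, hw]⟩

theorem toTensorAlgebra_braidGenerator_zero_of_eq_sum (hC : c.HasCoeffs e C) {n : ℕ} (j : ι)
    {u w : ⨂[k]^n V} (hw : toTensorAlgebra w =
      ∑ i, TensorAlgebra.ι k (e i) * skewDeriv e C i (toTensorAlgebra u)) :
    toTensorAlgebra (braidGenerator c (n + 1) 0 (consTensor n (e j) w)) =
      ∑ m, TensorAlgebra.ι k (e m) * ∑ i, ∑ l,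
        C j i m l • (TensorAlgebra.ι k (e l) * skewDeriv e C i (toTensorAlgebra u)) := by
  cases n with
  | zero =>
    have hD := skewCalculus_skewDeriv e C
    obtain ⟨r, hr⟩ := toTensorAlgebra_zero u
    have hw0 : w = 0 := toTensorAlgebra_injective 0 (by
      simp [hw, hr, Algebra.algebraMap_eq_smul_one, hD.one])
    simp [hw0, hr, Algebra.algebraMap_eq_smul_one, hD.one]
  | succ n =>
    choose v hv using skewDeriv_mem_range e C u
    have hw' : w = ∑ i, consTensor n (e i) (v i) := toTensorAlgebra_injective _ (by simp [hw, hv])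
    simp only [hw', map_sum, toTensorAlgebra_braidGenerator_zero, hC j, map_smul, pairMul_tmul,
      hv, Finset.sum_mul, Finset.mul_sum, smul_mul_assoc, mul_smul_comm, mul_assoc]
    exact Finset.sum_comm

theorem toTensorAlgebra_shuffleSum (hC : c.HasCoeffs e C) {n : ℕ} (u : ⨂[k]^n V) :
    toTensorAlgebra (shuffleSum c n u) =
      ∑ m, TensorAlgebra.ι k (e m) * skewDeriv e C m (toTensorAlgebra u) := by
  have hD := skewCalculus_skewDeriv e C
  induction n with
  | zero =>
    obtain ⟨r, hr⟩ := toTensorAlgebra_zero u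
    simp [shuffleSum, hr, Algebra.algebraMap_eq_smul_one, hD.one]
  | succ n ih =>
    induction u using consTensor_induction e with
    | zero => simp
    | add u v hu hv => simp [hu, hv, mul_add, Finset.sum_add_distrib]
    | smul r u hu => simp [hu, Finset.smul_sum]
    | cons j u =>
      simp only [shuffleSum_consTensor, map_add, toTensorAlgebra_consTensor,
        toTensorAlgebra_braidGenerator_zero_of_eq_sum hC j (ih u), hD.mul, mul_add,
        Finset.sum_add_distrib, mul_ite, mul_zero, Finset.sum_ite_eq', Finset.mem_univ, if_true]

theorem mem_relations_succ (hC : c.HasCoeffs e C) {n : ℕ} (u : ⨂[k]^(n + 1) V) :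
    toTensorAlgebra u ∈ relations c (n + 1) ↔
      ∀ m, skewDeriv e C m (toTensorAlgebra u) ∈ relations c n := by
  choose w hw using skewDeriv_mem_range e C u
  have hu : shuffleSum c (n + 1) u = ∑ m, consTensor n (e m) (w m) :=
    toTensorAlgebra_injective _ (by simp [toTensorAlgebra_shuffleSum hC, hw])
  simp only [← hw, mem_relations, quantumSymmetrizer_succ_of_shuffleSum c hu]
  refine ⟨fun h m => toTensorAlgebra_injective n ?_, fun h => by simp [h]⟩
  rw [map_zero]
  exact eq_zero_of_sum_ι_mul_eq_zero e
    (a := fun m => toTensorAlgebra (quantumSymmetrizer c n (w m)))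
    (by simpa using congrArg toTensorAlgebra h) m

end Relations

/-! ### Presentations of Nichols algebras -/

section Presentation

variable {k V : Type*} [Field k] [AddCommGroup V] [Module k V]

/-- The algebra `T(V) / ⟨R⟩`. -/
abbrev Presented (R : Set (TensorAlgebra k V)) : Type _ :=
  RingQuot fun x y : TensorAlgebra k V => x ∈ R ∧ y = 0

/-- The quotient map `T(V) → T(V) / ⟨R⟩`. -/
noncomputable def Presented.mk (R : Set (TensorAlgebra k V)) :
    TensorAlgebra k V →ₐ[k] Presented R :=
  RingQuot.mkAlgHom k _

theorem Presented.mk_surjective (R : Set (TensorAlgebra k V)) : Function.Surjective (mk R) :=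
  RingQuot.mkAlgHom_surjective k _

theorem Presented.mk_eq_zero {R : Set (TensorAlgebra k V)} {r : TensorAlgebra k V} (hr : r ∈ R) :
    mk R r = 0 :=
  (RingQuot.mkAlgHom_rel k (s := fun x y => x ∈ R ∧ y = 0) ⟨hr, rfl⟩).trans (map_zero _)

theorem Presented.exists_lift {B : Type*} [Semiring B] [Algebra k B] {R : Set (TensorAlgebra k V)}
    (f : TensorAlgebra k V →ₐ[k] B) (hf : ∀ r ∈ R, f r = 0) :
    ∃ g : Presented R →ₐ[k] B, ∀ w, g (mk R w) = f w :=
  ⟨RingQuot.liftAlgHom k ⟨f, fun _ _ ⟨hx, hy⟩ => by rw [hf _ hx, hy, map_zero]⟩,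
    RingQuot.liftAlgHom_mkAlgHom_apply k f _⟩

theorem Presented.mk_eq_zero_iff (R : Set (TensorAlgebra k V)) (w : TensorAlgebra k V) :
    mk R w = 0 ↔ w ∈ TwoSidedIdeal.span R := by
  refine ⟨fun h => ?_, fun h => ?_⟩
  · let f : Presented R →+* (TwoSidedIdeal.span R).ringCon.Quotient :=
      RingQuot.lift ⟨(TwoSidedIdeal.span R).ringCon.mk', fun x y ⟨hx, hy⟩ => by
        rw [hy, map_zero, ← TwoSidedIdeal.mem_ker, TwoSidedIdeal.ker_ringCon_mk']
        exact TwoSidedIdeal.subset_span hx⟩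
    have hf : f (RingQuot.mkRingHom _ w) = (TwoSidedIdeal.span R).ringCon.mk' w :=
      RingQuot.lift_mkRingHom_apply _ _ _
    rw [← RingQuot.mkAlgHom_coe k] at hf
    rw [← TwoSidedIdeal.ker_ringCon_mk' (TwoSidedIdeal.span R), TwoSidedIdeal.mem_ker, ← hf]
    exact (congrArg f h).trans (map_zero f)
  · rw [← TwoSidedIdeal.mem_ker]
    exact TwoSidedIdeal.span_le.2 (fun r hr => (TwoSidedIdeal.mem_ker _).2 (mk_eq_zero hr)) h

theorem Presented.adjoin_range_mk_ι {ι : Type*} (e : Module.Basis ι k V)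
    (R : Set (TensorAlgebra k V)) :
    Algebra.adjoin k (Set.range fun j => mk R (TensorAlgebra.ι k (e j))) = ⊤ := by
  rw [Set.range_comp' (mk R), ← AlgHom.map_adjoin, adjoin_range_ι_basis, Algebra.map_top,
    AlgHom.range_eq_top]
  exact mk_surjective R

theorem Presented.exists_augmentation {R : Set (TensorAlgebra k V)}
    (hR : R ⊆ Set.range (pairMul k V)) :
    ∃ ε : Presented R →ₐ[k] k, ∀ v, ε (mk R (TensorAlgebra.ι k v)) = 0 := by
  have hpair (z : V ⊗[k] V) : TensorAlgebra.lift k (0 : V →ₗ[k] k) (pairMul k V z) = 0 := by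
    induction z using TensorProduct.induction_on with
    | zero => simp
    | tmul v w => simp
    | add u v hu hv => simp [hu, hv]
  obtain ⟨ε, hε⟩ := Presented.exists_lift (R := R) (TensorAlgebra.lift k (0 : V →ₗ[k] k)) <| by
    intro r hr
    obtain ⟨z, rfl⟩ := hR hr
    exact hpair z
  exact ⟨ε, fun v => by simp [hε]⟩

variable {ι : Type*} {e : Module.Basis ι k V}

theorem augmentation_toTensorAlgebra_succ {A : Type*} [Semiring A] [Algebra k A]
    {π : TensorAlgebra k V →ₐ[k] A} {ε : A →ₐ[k] k}
    (hε : ∀ j, ε (π (TensorAlgebra.ι k (e j))) = 0) {n : ℕ} (u : ⨂[k]^(n + 1) V) :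
    ε (π (TensorPower.toTensorAlgebra u)) = 0 := by
  induction u using consTensor_induction e with
  | zero => simp
  | cons j w => simp [hε]
  | add u v hu hv => simp [hu, hv]
  | smul r u hu => simp [hu]

variable [Fintype ι] [DecidableEq ι] {C : ι → ι → ι → ι → k}

theorem Presented.exists_skewCalculus {R : Set (TensorAlgebra k V)}
    (hR : ∀ r ∈ R, skewRep e C (fun j => mk R (TensorAlgebra.ι k (e j))) r = 0) :
    ∃ D, SkewCalculus C (fun j => mk R (TensorAlgebra.ι k (e j))) D := by
  obtain ⟨Ψ, hΨ⟩ := exists_lift _ hR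
  exact ⟨_, .of_algHom (Ψ := Ψ) (adjoin_range_mk_ι e R) fun j => by rw [hΨ, skewRep_ι]⟩

variable {c : Braiding k V}

theorem toTensorAlgebra_mem_relations_iff (hC : c.HasCoeffs e C)
    {A : Type*} [Ring A] [Algebra k A] {π : TensorAlgebra k V →ₐ[k] A} {D : ι → A →ₗ[k] A}
    (hD : SkewCalculus C (fun j => π (TensorAlgebra.ι k (e j))) D)
    {ε : A →ₐ[k] k} (hε : ∀ j, ε (π (TensorAlgebra.ι k (e j))) = 0)
    (hker : ∀ w, (∀ m, D m w = 0) → ∃ r, w = algebraMap k A r) {n : ℕ} (u : ⨂[k]^n V) :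
    TensorPower.toTensorAlgebra u ∈ relations c n ↔ π (TensorPower.toTensorAlgebra u) = 0 := by
  induction n with
  | zero =>
    obtain ⟨r, hr⟩ := toTensorAlgebra_zero u
    rw [relations_zero, Submodule.mem_bot, hr]
    refine ⟨fun h => by rw [h, map_zero], fun h => ?_⟩
    have hr0 : r = 0 := by simpa using congrArg ε h
    rw [hr0, map_zero]
  | succ n ih =>
    have hDπ : (∀ m, skewDeriv e C m (TensorPower.toTensorAlgebra u) ∈ relations c n) ↔
        ∀ m, D m (π (TensorPower.toTensorAlgebra u)) = 0 := forall_congr' fun m => by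
      obtain ⟨w, hw⟩ := skewDeriv_mem_range e C u m
      rw [← hD.map_skewDeriv, ← hw, ih]
    rw [mem_relations_succ hC, hDπ]
    refine ⟨fun h => ?_, fun h m => by rw [h, map_zero]⟩
    obtain ⟨r, hr⟩ := hker _ h
    have hr0 : r = 0 := by simpa [hr] using augmentation_toTensorAlgebra_succ hε u
    rw [hr, hr0, map_zero]

theorem mul_pairMul_mul_mem_definingIdeal {A : Type*} [Semiring A] [Algebra k A]
    {π : TensorAlgebra k V →ₐ[k] A}
    (h : ∀ n (u : ⨂[k]^n V), π (TensorPower.toTensorAlgebra u) = 0 →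
      TensorPower.toTensorAlgebra u ∈ relations c n)
    {z : V ⊗[k] V} (hz : π (pairMul k V z) = 0) (u v : TensorAlgebra k V) :
    u * pairMul k V z * v ∈ definingIdeal c := by
  induction u using homogeneous_induction with
  | zero => simp
  | add u u' hu hu' => simpa only [add_mul] using add_mem hu hu'
  | hom i u =>
    induction v using homogeneous_induction with
    | zero => simp
    | add v v' hv hv' => simpa only [mul_add] using add_mem hv hv'
    | hom j v =>
      have huv : TensorPower.toTensorAlgebra
          (TensorPower.mulEquiv (TensorPower.mulEquiv (u ⊗ₜ pairEquiv k V z) ⊗ₜ v)) =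
          TensorPower.toTensorAlgebra u * pairMul k V z * TensorPower.toTensorAlgebra v := by
        simp
      refine Submodule.mem_iSup_of_mem (i + 2 + j) (Submodule.mem_iSup_of_mem (by omega) ?_)
      exact huv ▸ h _ _ (by rw [huv, map_mul, map_mul, hz, mul_zero, zero_mul])

open scoped Pointwise in
theorem definingIdeal_eq_span {R : Set (TensorAlgebra k V)}
    (hR : R ⊆ Set.range (pairMul k V))
    (h : ∀ n (u : ⨂[k]^n V), TensorPower.toTensorAlgebra u ∈ relations c n ↔
      Presented.mk R (TensorPower.toTensorAlgebra u) = 0) :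
    (definingIdeal c : Set (TensorAlgebra k V)) = TwoSidedIdeal.span R := by
  apply Set.Subset.antisymm
  · have hle : definingIdeal c ≤ LinearMap.ker (Presented.mk R).toLinearMap := by
      refine iSup₂_le fun n _ => ?_
      rintro _ ⟨u, hu, rfl⟩
      exact (h n u).1 ⟨u, hu, rfl⟩
    exact fun w hw => (Presented.mk_eq_zero_iff R w).1 (hle hw)
  · intro w hw
    rw [SetLike.mem_coe, TwoSidedIdeal.mem_span_iff_mem_addSubgroup_closure] at hw
    suffices hle : AddSubgroup.closure (Set.univ * R * Set.univ) ≤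
        (definingIdeal c).toAddSubgroup from hle hw
    rw [AddSubgroup.closure_le]
    rintro _ ⟨_, ⟨u, -, r, hr, rfl⟩, v, -, rfl⟩
    obtain ⟨z, rfl⟩ := hR hr
    exact mul_pairMul_mul_mem_definingIdeal (fun n u => (h n u).2) (Presented.mk_eq_zero hr) u v

theorem definingIdeal_eq_span_of_iInf_ker_le (hC : c.HasCoeffs e C) {R : Set (TensorAlgebra k V)}
    (hR : R ⊆ Set.range (pairMul k V)) {D : ι → Presented R →ₗ[k] Presented R}
    (hD : SkewCalculus C (fun j => Presented.mk R (TensorAlgebra.ι k (e j))) D)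
    (hker : ⨅ m, LinearMap.ker (D m) ≤ k ∙ 1) :
    (definingIdeal c : Set (TensorAlgebra k V)) = TwoSidedIdeal.span R := by
  obtain ⟨ε, hε⟩ := Presented.exists_augmentation hR
  refine definingIdeal_eq_span hR fun n u =>
    toTensorAlgebra_mem_relations_iff hC hD (fun j => hε (e j)) (fun w hw => ?_) u
  obtain ⟨r, hr⟩ := Submodule.mem_span_singleton.1 (hker (by simpa using hw))
  exact ⟨r, by rw [← hr, Algebra.algebraMap_eq_smul_one]⟩

end Presentation

/-! ### The braiding of `ℜ_{1,3}` -/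

section RankThree

variable {k : Type*} [Field k]

/-- The structure constants of `braiding13` in the standard basis, read off the `R`-matrix. -/
def coeff13 (a b p q t : k) (i j m l : Fin 3) : k :=
  R13 a b p q t (finProdFinEquiv (m, l)) (finProdFinEquiv (j, i))

theorem hasCoeffs_coeff13 (a b p q t : k) (ht : t ≠ 0) :
    (braiding13 a b p q t ht).HasCoeffs (Pi.basisFun k (Fin 3)) (coeff13 a b p q t) := by
  intro i j
  simp only [Pi.basisFun_apply]
  exact mapOfMatrix_tmul _ i j

theorem X_eq (i : Fin 3) : X k i = TensorAlgebra.ι k (Pi.basisFun k (Fin 3) i) := by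
  rw [Pi.basisFun_apply]
  rfl

variable {A : Type*} [Ring A] [Algebra k A]

/-- The entry `(j, m)` is the `m`-th skew derivative of `y j * w` if `f i` is the `i`-th skew
derivative of `w`. -/
def leibniz13 (a b p q t : k) (y : Fin 3 → A) (w : A) (f : Fin 3 → A) :
    Matrix (Fin 3) (Fin 3) A :=
  !![w + t • (y 0 * f 0) - (t * a) • (y 0 * f 2), t • (y 0 * f 1), t • (y 0 * f 2);
    t • (y 1 * f 0) - (t * b) • (y 1 * f 2), w + t • (y 1 * f 1), t • (y 1 * f 2);
    t • (y 2 * f 0) + (t * a) • (y 0 * f 0) - (t * b) • (y 2 * f 2) -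
      (t * p) • (y 1 * f 2) - (t * a * b) • (y 0 * f 2),
    t • (y 2 * f 1) + (t * b) • (y 0 * f 1) + (t * q) • (y 1 * f 2) + (t * p) • (y 0 * f 2),
    w + t • (y 2 * f 2) + (t * b) • (y 0 * f 2)]

theorem add_sum_coeff13 (a b p q t : k) (y : Fin 3 → A) (w : A) (f : Fin 3 → A) (j m : Fin 3) :
    (if m = j then w else 0) + ∑ i, ∑ l, coeff13 a b p q t j i m l • (y l * f i) =
      leibniz13 a b p q t y w f j m := by
  have hval (m l : Fin 3) : (finProdFinEquiv (m, l) : Fin 9) = ⟨l + 3 * m, by omega⟩ := rfl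
  fin_cases j <;> fin_cases m <;>
  · simp [Fin.sum_univ_three, coeff13, hval, R13, leibniz13]
    try module

theorem skewOp_coeff13 (a b p q t : k) (y : Fin 3 → A) (j : Fin 3) (w : A) (f : Fin 3 → A) :
    skewOp (coeff13 a b p q t) y j (w, f) = (y j * w, leibniz13 a b p q t y w f j) :=
  Prod.ext rfl (funext fun m => add_sum_coeff13 a b p q t y w f j m)

theorem SkewCalculus.map_mul13 {a b p q t : k} {y : Fin 3 → A} {D : Fin 3 → A →ₗ[k] A}
    (hD : SkewCalculus (coeff13 a b p q t) y D) (m j : Fin 3) (w : A) :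
    D m (y j * w) = leibniz13 a b p q t y w (D · w) j m := by
  rw [hD.mul, add_sum_coeff13]

/-- The relations of the Nichols algebra for `t = 1`. -/
def relSymm (a b : k) : Set (TensorAlgebra k (Fin 3 → k)) :=
  {X k 1 * X k 0 - X k 0 * X k 1, X k 2 * X k 0 - X k 0 * X k 2 - a • X k 0 ^ 2,
    X k 2 * X k 1 - X k 1 * X k 2 - b • (X k 0 * X k 1)}

/-- The relations of the Nichols algebra for `t = -1` and `q ≠ 0`. -/
def relSkew (b : k) : Set (TensorAlgebra k (Fin 3 → k)) :=
  {X k 1 * X k 0 + X k 0 * X k 1, X k 2 * X k 0 + X k 0 * X k 2,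
    X k 2 * X k 1 + X k 1 * X k 2 - b • (X k 0 * X k 1), X k 0 ^ 2, X k 1 ^ 2}

/-- The relations of the Nichols algebra for `t = -1` and `q = 0`. -/
def relExt (b p : k) : Set (TensorAlgebra k (Fin 3 → k)) :=
  {X k 1 * X k 0 + X k 0 * X k 1, X k 2 * X k 0 + X k 0 * X k 2,
    X k 2 * X k 1 + X k 1 * X k 2 - b • (X k 0 * X k 1), X k 0 ^ 2, X k 1 ^ 2,
    X k 2 ^ 2 - b • (X k 0 * X k 2) - p • (X k 0 * X k 1)}

/-- The relations `relSymm` as straightening rules in an algebra. -/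
structure SymmRel (a b : k) (y : Fin 3 → A) : Prop where
  swap10 : y 1 * y 0 = y 0 * y 1
  swap20 : y 2 * y 0 = y 0 * y 2 + a • (y 0 * y 0)
  swap21 : y 2 * y 1 = y 1 * y 2 + b • (y 0 * y 1)

/-- The relations `relSkew` as straightening rules in an algebra. -/
structure SkewRel (b : k) (y : Fin 3 → A) : Prop where
  swap10 : y 1 * y 0 = -(y 0 * y 1)
  swap20 : y 2 * y 0 = -(y 0 * y 2)
  swap21 : y 2 * y 1 = b • (y 0 * y 1) - y 1 * y 2
  sq0 : y 0 * y 0 = 0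
  sq1 : y 1 * y 1 = 0

/-- The relations `relExt` as straightening rules in an algebra. -/
structure ExtRel (b p : k) (y : Fin 3 → A) : Prop extends SkewRel b y where
  sq2 : y 2 * y 2 = b • (y 0 * y 2) + p • (y 0 * y 1)

theorem symmRel_iff (a b : k) (π : TensorAlgebra k (Fin 3 → k) →ₐ[k] A) :
    (∀ r ∈ relSymm a b, π r = 0) ↔ SymmRel a b fun j => π (X k j) := by
  simp only [relSymm, Set.mem_insert_iff, Set.mem_singleton_iff, forall_eq_or_imp, forall_eq,
    map_sub, map_mul, map_smul, pow_two, sub_eq_zero]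
  exact ⟨fun ⟨h10, h20, h21⟩ => ⟨h10, sub_eq_iff_eq_add'.1 h20, sub_eq_iff_eq_add'.1 h21⟩,
    fun ⟨h10, h20, h21⟩ => ⟨h10, sub_eq_iff_eq_add'.2 h20, sub_eq_iff_eq_add'.2 h21⟩⟩

theorem skewRel_iff (b : k) (π : TensorAlgebra k (Fin 3 → k) →ₐ[k] A) :
    (∀ r ∈ relSkew b, π r = 0) ↔ SkewRel b fun j => π (X k j) := by
  simp only [relSkew, Set.mem_insert_iff, Set.mem_singleton_iff, forall_eq_or_imp, forall_eq,
    map_sub, map_add, map_mul, map_smul, pow_two, add_eq_zero_iff_eq_neg, sub_eq_zero]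
  exact ⟨fun ⟨h10, h20, h21, h0, h1⟩ => ⟨h10, h20, eq_sub_of_add_eq h21, h0, h1⟩,
    fun ⟨h10, h20, h21, h0, h1⟩ => ⟨h10, h20, add_eq_of_eq_sub h21, h0, h1⟩⟩

theorem extRel_iff (b p : k) (π : TensorAlgebra k (Fin 3 → k) →ₐ[k] A) :
    (∀ r ∈ relExt b p, π r = 0) ↔ ExtRel b p fun j => π (X k j) := by
  have hsplit : (∀ r ∈ relExt b p, π r = 0) ↔ (∀ r ∈ relSkew b, π r = 0) ∧
      π (X k 2) * π (X k 2) - (b • (π (X k 0) * π (X k 2)) + p • (π (X k 0) * π (X k 1))) = 0 := by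
    simp [relSkew, relExt, pow_two, and_assoc, sub_sub]
  rw [hsplit, skewRel_iff, sub_eq_zero]
  exact ⟨fun ⟨h, h2⟩ => ⟨h, h2⟩, fun ⟨h, h2⟩ => ⟨h, h2⟩⟩

variable {a b p q : k} {y : Fin 3 → A}

theorem SymmRel.swap10_assoc (h : SymmRel a b y) (w : A) : y 1 * (y 0 * w) = y 0 * (y 1 * w) := by
  rw [← mul_assoc, h.swap10, mul_assoc]

theorem SymmRel.swap20_assoc (h : SymmRel a b y) (w : A) :
    y 2 * (y 0 * w) = y 0 * (y 2 * w) + a • (y 0 * (y 0 * w)) := by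
  rw [← mul_assoc, h.swap20, add_mul, smul_mul_assoc, mul_assoc, mul_assoc]

theorem SymmRel.swap21_assoc (h : SymmRel a b y) (w : A) :
    y 2 * (y 1 * w) = y 1 * (y 2 * w) + b • (y 0 * (y 1 * w)) := by
  rw [← mul_assoc, h.swap21, add_mul, smul_mul_assoc, mul_assoc, mul_assoc]

theorem SkewRel.swap10_assoc (h : SkewRel b y) (w : A) : y 1 * (y 0 * w) = -(y 0 * (y 1 * w)) := by
  rw [← mul_assoc, h.swap10, neg_mul, mul_assoc]

theorem SkewRel.swap20_assoc (h : SkewRel b y) (w : A) : y 2 * (y 0 * w) = -(y 0 * (y 2 * w)) := by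
  rw [← mul_assoc, h.swap20, neg_mul, mul_assoc]

theorem SkewRel.swap21_assoc (h : SkewRel b y) (w : A) :
    y 2 * (y 1 * w) = b • (y 0 * (y 1 * w)) - y 1 * (y 2 * w) := by
  rw [← mul_assoc, h.swap21, sub_mul, smul_mul_assoc, mul_assoc, mul_assoc]

theorem SkewRel.sq0_assoc (h : SkewRel b y) (w : A) : y 0 * (y 0 * w) = 0 := by
  rw [← mul_assoc, h.sq0, zero_mul]

theorem SkewRel.sq1_assoc (h : SkewRel b y) (w : A) : y 1 * (y 1 * w) = 0 := by
  rw [← mul_assoc, h.sq1, zero_mul]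

theorem ExtRel.sq2_assoc (h : ExtRel b p y) (w : A) :
    y 2 * (y 2 * w) = b • (y 0 * (y 2 * w)) + p • (y 0 * (y 1 * w)) := by
  rw [← mul_assoc, h.sq2, add_mul, smul_mul_assoc, smul_mul_assoc, mul_assoc, mul_assoc]

theorem SymmRel.skewOp (h : SymmRel a b y) :
    SymmRel a b (Nichols.skewOp (coeff13 a b p q 1) y) := by
  constructor
  all_goals
    refine LinearMap.ext fun ⟨w, f⟩ => Prod.ext ?_ (funext fun m => ?_)
    · simp [skewOp_coeff13, h.swap10_assoc, h.swap20_assoc, h.swap21_assoc]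
    · simp only [Module.End.mul_apply, LinearMap.add_apply, LinearMap.smul_apply, skewOp_coeff13,
        leibniz13, Matrix.of_apply, Matrix.cons_val]
      fin_cases m <;>
      · simp [h.swap10_assoc, h.swap20_assoc, h.swap21_assoc, mul_add, mul_sub]
        try module

theorem SkewRel.skewOp (h : SkewRel b y) :
    SkewRel b (Nichols.skewOp (coeff13 a b p q (-1)) y) := by
  constructor
  all_goals
    refine LinearMap.ext fun ⟨w, f⟩ => Prod.ext ?_ (funext fun m => ?_)
    · simp [skewOp_coeff13, h.swap10_assoc, h.swap20_assoc, h.swap21_assoc, h.sq0_assoc,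
        h.sq1_assoc]
    · simp only [Module.End.mul_apply, LinearMap.sub_apply, LinearMap.neg_apply,
        LinearMap.zero_apply, LinearMap.smul_apply, skewOp_coeff13, leibniz13, Matrix.of_apply,
        Matrix.cons_val]
      fin_cases m <;>
      · simp [h.swap10_assoc, h.swap20_assoc, h.swap21_assoc, h.sq0_assoc, h.sq1_assoc, mul_add]
        try module

theorem ExtRel.skewOp (h : ExtRel b p y) :
    ExtRel b p (Nichols.skewOp (coeff13 a b p 0 (-1)) y) := by
  refine ⟨h.toSkewRel.skewOp, LinearMap.ext fun ⟨w, f⟩ => Prod.ext ?_ (funext fun m => ?_)⟩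
  · simp [skewOp_coeff13, h.sq2_assoc]
  · simp only [Module.End.mul_apply, LinearMap.add_apply, LinearMap.smul_apply, skewOp_coeff13,
      leibniz13, Matrix.of_apply, Matrix.cons_val]
    fin_cases m <;>
    · simp [h.swap10_assoc, h.swap20_assoc, h.swap21_assoc, h.sq0_assoc, h.sq2_assoc, mul_add]
      try module

end RankThree

/-! ### Triangular functionals on the monomials -/

section Triangular

variable {k ι M : Type*} [Field k] [AddCommGroup M] [Module k M]

/-- The family `v` admits functionals which are triangular with respect to the degree `d`, and
which vanish on the subspace `K` except for the one belonging to the index `i₀` of least degree. -/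
structure HasTriangularFunctionals (v : ι → M) (d : ι → ℕ) (K : Submodule k M) (i₀ : ι) :
    Prop where
  le : ∀ i, d i₀ ≤ d i
  exists_dual : ∀ i, ∃ F : Module.Dual k M, F (v i) ≠ 0 ∧
    (∀ j ≠ i, d j ≤ d i → F (v j) = 0) ∧ (i ≠ i₀ → K ≤ LinearMap.ker F)

variable {v : ι → M} {d : ι → ℕ} {K : Submodule k M} {i₀ : ι}

theorem HasTriangularFunctionals.eq_of_mem_support (h : HasTriangularFunctionals v d K i₀)
    {l : ι →₀ k} (hl : Finsupp.linearCombination k v l ∈ K) {i : ι} (hi : i ∈ l.support) :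
    i = i₀ := by
  classical
  by_contra hne
  obtain ⟨j, hj, hmax⟩ := (l.support.erase i₀).exists_max_image d
    ⟨i, Finset.mem_erase.2 ⟨hne, hi⟩⟩
  obtain ⟨hj₀, hj⟩ := Finset.mem_erase.1 hj
  obtain ⟨F, hFj, hF, hFK⟩ := h.exists_dual j
  have hlj : l j * F (v j) = 0 := by
    rw [← LinearMap.mem_ker.1 (hFK hj₀ hl), Finsupp.linearCombination_apply, Finsupp.sum, map_sum,
      Finset.sum_eq_single_of_mem j hj, map_smul, smul_eq_mul]
    intro i' hi' hij
    rw [map_smul, hF i' hij, smul_zero]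
    obtain rfl | hi₀ := eq_or_ne i' i₀
    exacts [h.le j, hmax i' (Finset.mem_erase.2 ⟨hi₀, hi'⟩)]
  exact mul_ne_zero (Finsupp.mem_support_iff.1 hj) hFj hlj

theorem HasTriangularFunctionals.eq_single (h : HasTriangularFunctionals v d K i₀)
    {l : ι →₀ k} (hl : Finsupp.linearCombination k v l ∈ K) : l = Finsupp.single i₀ (l i₀) :=
  Finsupp.support_subset_singleton.1 fun _ hi => Finset.mem_singleton.2 (h.eq_of_mem_support hl hi)

theorem HasTriangularFunctionals.linearIndependent (h : HasTriangularFunctionals v d K i₀) :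
    LinearIndependent k v := by
  refine linearIndependent_iff.2 fun l hl => ?_
  have hsingle := h.eq_single (hl ▸ zero_mem K)
  obtain ⟨F, hF, -⟩ := h.exists_dual i₀
  have hv : v i₀ ≠ 0 := fun h0 => hF (by rw [h0, map_zero])
  rw [hsingle, Finsupp.linearCombination_single, smul_eq_zero, or_iff_left hv] at hl
  rw [hsingle, hl, Finsupp.single_zero]

theorem HasTriangularFunctionals.le_span_singleton (h : HasTriangularFunctionals v d K i₀)
    (hv : Submodule.span k (Set.range v) = ⊤) : K ≤ k ∙ v i₀ := by
  intro w hw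
  obtain ⟨l, rfl⟩ : w ∈ LinearMap.range (Finsupp.linearCombination k v) := by
    rw [Finsupp.range_linearCombination, hv]
    exact Submodule.mem_top
  rw [h.eq_single hw, Finsupp.linearCombination_single]
  exact Submodule.smul_mem _ _ (Submodule.mem_span_singleton_self _)

end Triangular

section LeadingMaps

variable {k : Type*} [Field k] {A : Type*} [Ring A] [Algebra k A]

/-- The monomial `x_1^{a_1} x_2^{a_2} x_3^{a_3}` for `x_{j+1} = y j` and `e = (a_1, a_2, a_3)`. -/
def mon (y : Fin 3 → A) (e : ℕ × ℕ × ℕ) : A := y 0 ^ e.1 * y 1 ^ e.2.1 * y 2 ^ e.2.2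

theorem map_mon {B : Type*} [Ring B] [Algebra k B] (g : A →ₐ[k] B)
    (y : Fin 3 → A) (e : ℕ × ℕ × ℕ) : g (mon y e) = mon (fun j => g (y j)) e := by
  simp [mon]

/-- Linear maps `H n` on an algebra that send monomials of degree less than `n` in `y 2` to zero,
remove the factor `y 2 ^ n` from those of degree `n` (both up to scalars given by `u` and `s`), and
vanish for `n ≠ 0` on the common kernel of the `D m`. -/
structure LeadingMaps (y : Fin 3 → A) (D : Fin 3 → A →ₗ[k] A) (H : ℕ → Module.End k A)
    (u s : ℕ → k) : Prop where
  zero : H 0 = 1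
  succ_const : ∀ n w, (∀ m, D m w = 0) → H (n + 1) w = 0
  mul0 : ∀ n w, H n (y 0 * w) = u n • (y 0 * H n w)
  mul1 : ∀ n w, H n (y 1 * w) = u n • (y 1 * H n w)
  mul2 : ∀ n, ∃ g, ∀ w, H (n + 1) (y 2 * w) = s n • H n w + g * H (n + 1) w

variable {y : Fin 3 → A} {D : Fin 3 → A →ₗ[k] A} {H : ℕ → Module.End k A} {u s : ℕ → k}

theorem LeadingMaps.apply_pow_of_lt (hH : LeadingMaps y D H u s) (hD : ∀ m, D m 1 = 0) {c n : ℕ}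
    (hc : c < n) : H n (y 2 ^ c) = 0 := by
  obtain ⟨n, rfl⟩ := Nat.exists_eq_succ_of_ne_zero (Nat.ne_zero_of_lt hc)
  induction c generalizing n with
  | zero => rw [pow_zero, hH.succ_const n 1 hD]
  | succ c ih =>
    obtain ⟨m, rfl⟩ := Nat.exists_eq_succ_of_ne_zero (n := n) (by omega)
    obtain ⟨g, hg⟩ := hH.mul2 (m + 1)
    rw [pow_succ', hg, ih m (by omega), ih (m + 1) (by omega), smul_zero, mul_zero, add_zero]

theorem LeadingMaps.apply_pow_self (hH : LeadingMaps y D H u s) (hD : ∀ m, D m 1 = 0) (n : ℕ) :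
    H n (y 2 ^ n) = (∏ i ∈ Finset.range n, s i) • 1 := by
  induction n with
  | zero => simp [hH.zero]
  | succ n ih =>
    obtain ⟨g, hg⟩ := hH.mul2 n
    rw [pow_succ', hg, ih, hH.apply_pow_of_lt hD n.lt_succ_self, mul_zero, add_zero, smul_smul,
      Finset.prod_range_succ_comm]

theorem apply_pow_mul_of_apply_mul {f : Module.End k A} {z : A} {r : k}
    (h : ∀ w, f (z * w) = r • (z * f w)) (i : ℕ) (w : A) :
    f (z ^ i * w) = r ^ i • (z ^ i * f w) := by
  induction i with
  | zero => simp
  | succ i ih => rw [pow_succ', mul_assoc, h, ih, mul_smul_comm, smul_smul, mul_assoc, pow_succ']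

theorem pow_apply_mul_of_apply_mul {f : Module.End k A} {z : A} (h : ∀ w, f (z * w) = z * f w)
    (n : ℕ) (w : A) : (f ^ n) (z * w) = z * (f ^ n) w := by
  induction n generalizing w with
  | zero => simp
  | succ n ih => rw [pow_succ, Module.End.mul_apply, h, ih, Module.End.mul_apply]

theorem LeadingMaps.apply_mon (hH : LeadingMaps y D H u s) (n : ℕ) (e : ℕ × ℕ × ℕ) :
    H n (mon y e) = (u n ^ (e.1 + e.2.1)) • (y 0 ^ e.1 * y 1 ^ e.2.1 * H n (y 2 ^ e.2.2)) := by
  rw [mon, mul_assoc, apply_pow_mul_of_apply_mul (hH.mul0 n),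
    apply_pow_mul_of_apply_mul (hH.mul1 n), mul_smul_comm, smul_smul, pow_add, mul_assoc]

theorem end_pow_apply_eq_zero {f : Module.End k A} {w : A} (h : f w = 0) {n : ℕ} (hn : n ≠ 0) :
    (f ^ n) w = 0 := by
  obtain ⟨m, rfl⟩ := Nat.exists_eq_succ_of_ne_zero hn
  rw [pow_succ, Module.End.mul_apply, h, map_zero]

theorem LeadingMaps.hasTriangularFunctionals (hH : LeadingMaps y D H u s) (hD : ∀ m, D m 1 = 0)
    (hu : ∀ n, u n ≠ 0) {S : Set (ℕ × ℕ × ℕ)} (h0 : 0 ∈ S)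
    (hs : ∀ e ∈ S, ∏ i ∈ Finset.range e.2.2, s i ≠ 0) {ε : A →ₗ[k] k}
    (hself : ∀ e ∈ S, ε ((D 0 ^ e.1 * D 1 ^ e.2.1) (y 0 ^ e.1 * y 1 ^ e.2.1)) ≠ 0)
    (hne : ∀ e ∈ S, ∀ e' ∈ S, (e'.1 = e.1 → e'.2.1 ≠ e.2.1) →
      ε ((D 0 ^ e.1 * D 1 ^ e.2.1) (y 0 ^ e'.1 * y 1 ^ e'.2.1)) = 0) :
    HasTriangularFunctionals (fun e : S => mon y e) (fun e => e.1.2.2)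
      (⨅ m, LinearMap.ker (D m)) ⟨0, h0⟩ where
  le e := Nat.zero_le _
  exists_dual := by
    rintro ⟨e, he⟩
    refine ⟨ε ∘ₗ (D 0 ^ e.1 * D 1 ^ e.2.1) ∘ₗ H e.2.2, ?_, ?_, ?_⟩
    · simpa [hH.apply_mon, hH.apply_pow_self hD, hu] using ⟨hs e he, hself e he⟩
    · rintro ⟨e', he'⟩ hee hle
      rcases hle.lt_or_eq with hlt | heq
      · simp [hH.apply_mon, hH.apply_pow_of_lt hD hlt]
      · have hlow := hne e he e' he' fun h1 h2 => hee (Subtype.ext (Prod.ext h1 (Prod.ext h2 heq)))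
        simp only at heq
        rw [Module.End.mul_apply] at hlow
        simp [hH.apply_mon, ← heq, hH.apply_pow_self hD, hlow]
    · intro he₀ w hw
      replace hw : ∀ m, D m w = 0 := by simpa using hw
      simp only [LinearMap.mem_ker, LinearMap.comp_apply, Module.End.mul_apply]
      by_cases h3 : e.2.2 = 0
      · rw [h3, hH.zero, Module.End.one_apply]
        by_cases h2 : e.2.1 = 0
        · have h1 : e.1 ≠ 0 := fun h1 => he₀ (Subtype.ext (Prod.ext h1 (Prod.ext h2 h3)))
          rw [h2, pow_zero, Module.End.one_apply, end_pow_apply_eq_zero (hw 0) h1, map_zero]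
        · rw [end_pow_apply_eq_zero (hw 1) h2, map_zero, map_zero]
      · obtain ⟨n, hn⟩ := Nat.exists_eq_succ_of_ne_zero h3
        rw [hn, hH.succ_const n w hw, map_zero, map_zero, map_zero]

end LeadingMaps

section Symmetric

variable {k : Type*} [Field k] {A : Type*} [Ring A] [Algebra k A] {a b p q : k} {y : Fin 3 → A}
  {D : Fin 3 → A →ₗ[k] A}

theorem SkewCalculus.symm_mul0 (hD : SkewCalculus (coeff13 a b p q 1) y D) (n : ℕ) (w : A) :
    (D 2 ^ n) (y 0 * w) = y 0 * (D 2 ^ n) w :=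
  pow_apply_mul_of_apply_mul (fun w => by simp [hD.map_mul13, leibniz13]) n w

theorem SkewCalculus.symm_mul1 (hD : SkewCalculus (coeff13 a b p q 1) y D) (n : ℕ) (w : A) :
    (D 2 ^ n) (y 1 * w) = y 1 * (D 2 ^ n) w :=
  pow_apply_mul_of_apply_mul (fun w => by simp [hD.map_mul13, leibniz13]) n w

theorem SkewCalculus.symm_mul2 (hD : SkewCalculus (coeff13 a b p q 1) y D) (n : ℕ) (w : A) :
    (D 2 ^ (n + 1)) (y 2 * w) =
      (n + 1 : k) • (D 2 ^ n) w + (y 2 + ((n + 1) * b) • y 0) * (D 2 ^ (n + 1)) w := by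
  induction n generalizing w with
  | zero => simp [hD.map_mul13, leibniz13, add_mul, add_assoc]
  | succ n ih =>
    have hstep : D 2 (y 2 * w) = w + y 2 * D 2 w + b • (y 0 * D 2 w) := by
      simp [hD.map_mul13, leibniz13]
    rw [pow_succ, Module.End.mul_apply, hstep]
    simp only [map_add, map_smul, ih, hD.symm_mul0, ← Module.End.mul_apply, ← pow_succ, add_mul,
      smul_mul_assoc]
    push_cast
    module

theorem SkewCalculus.leadingMaps_symm (hD : SkewCalculus (coeff13 a b p q 1) y D) :
    LeadingMaps y D (D 2 ^ ·) 1 (fun n => n + 1) where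
  zero := pow_zero _
  succ_const n _ hw := end_pow_apply_eq_zero (hw 2) n.succ_ne_zero
  mul0 n w := by simp [hD.symm_mul0]
  mul1 n w := by simp [hD.symm_mul1]
  mul2 n := ⟨_, hD.symm_mul2 n⟩

theorem SkewCalculus.symm_map_two_eq_zero (hD : SkewCalculus (coeff13 a b p q 1) y D) (i j : ℕ) :
    D 2 (y 0 ^ i * y 1 ^ j) = 0 := by
  simpa [mon, hD.one] using hD.leadingMaps_symm.apply_mon 1 (i, j, 0)

theorem SkewCalculus.symm_map_one (hD : SkewCalculus (coeff13 a b p q 1) y D) (i j : ℕ) :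
    D 1 (y 0 ^ i * y 1 ^ j) = (j : k) • (y 0 ^ i * y 1 ^ (j - 1)) := by
  have hpow : D 1 (y 1 ^ j) = (j : k) • y 1 ^ (j - 1) := by
    induction j with
    | zero => simp [hD.one]
    | succ j ih =>
      have hstep (w : A) : D 1 (y 1 * w) = w + y 1 * D 1 w := by simp [hD.map_mul13, leibniz13]
      rw [pow_succ', hstep, ih]
      cases j <;> simp [pow_succ', add_smul, add_comm, mul_add]
  rw [apply_pow_mul_of_apply_mul (r := 1) fun w => by simp [hD.map_mul13, leibniz13], hpow, one_pow,
    one_smul, mul_smul_comm]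

theorem SkewCalculus.symm_map_zero (hD : SkewCalculus (coeff13 a b p q 1) y D) (i j : ℕ) :
    D 0 (y 0 ^ i * y 1 ^ j) = (i : k) • (y 0 ^ (i - 1) * y 1 ^ j) := by
  induction i with
  | zero =>
    induction j with
    | zero => simp [hD.one]
    | succ j ih =>
      have h2 := hD.symm_map_two_eq_zero 0 j
      simp only [pow_zero, one_mul] at h2 ih
      simp [pow_succ', hD.map_mul13, leibniz13, ih, h2]
  | succ i ih =>
    have hstep (w : A) : D 0 (y 0 * w) = w + y 0 * D 0 w - a • (y 0 * D 2 w) := by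
      simp [hD.map_mul13, leibniz13]
    rw [pow_succ', mul_assoc, hstep, ih, hD.symm_map_two_eq_zero]
    cases i <;> simp [pow_succ', add_smul, add_comm, mul_assoc, mul_add]

theorem SkewCalculus.symm_pow_map_pow (hD : SkewCalculus (coeff13 a b p q 1) y D) (m n i j : ℕ) :
    (D 0 ^ m * D 1 ^ n) (y 0 ^ i * y 1 ^ j) =
      ((i.descFactorial m * j.descFactorial n : ℕ) : k) • (y 0 ^ (i - m) * y 1 ^ (j - n)) := by
  have h1 : (D 1 ^ n) (y 0 ^ i * y 1 ^ j) =
      (j.descFactorial n : k) • (y 0 ^ i * y 1 ^ (j - n)) := by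
    induction n with
    | zero => simp
    | succ n ih =>
      rw [pow_succ', Module.End.mul_apply, ih, map_smul, hD.symm_map_one, smul_smul, Nat.sub_sub,
        ← Nat.cast_mul, mul_comm, ← Nat.descFactorial_succ]
  rw [Module.End.mul_apply, h1, map_smul, mul_comm, Nat.cast_mul, mul_smul]
  congr 1
  induction m with
  | zero => simp
  | succ m ih =>
    rw [pow_succ', Module.End.mul_apply, ih, map_smul, hD.symm_map_zero, smul_smul, Nat.sub_sub,
      ← Nat.cast_mul, mul_comm, ← Nat.descFactorial_succ]

theorem SkewCalculus.hasTriangularFunctionals_symm [CharZero k]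
    (hD : SkewCalculus (coeff13 a b p q 1) y D) {ε : A →ₐ[k] k} (hε : ∀ j, ε (y j) = 0) :
    HasTriangularFunctionals (fun e : B3 => mon y e) (fun e => e.1.2.2)
      (⨅ m, LinearMap.ker (D m)) ⟨0, Set.mem_univ _⟩ := by
  refine hD.leadingMaps_symm.hasTriangularFunctionals (ε := ε.toLinearMap) hD.one (by simp) _
    (fun e _ => Finset.prod_ne_zero_iff.2 fun i _ => i.cast_add_one_ne_zero) (fun e _ => ?_)
    fun e _ e' _ hne => ?_
  · simp [hD.symm_pow_map_pow, Nat.descFactorial_self, Nat.factorial_ne_zero]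
  · rw [hD.symm_pow_map_pow, map_smul, AlgHom.toLinearMap_apply, map_mul, map_pow, map_pow, hε, hε]
    rcases lt_trichotomy e'.1 e.1 with h | h | h
    · simp [Nat.descFactorial_of_lt h]
    · rcases (hne h).lt_or_gt with h' | h'
      · simp [Nat.descFactorial_of_lt h']
      · simp [zero_pow (Nat.sub_ne_zero_of_lt h')]
    · simp [zero_pow (Nat.sub_ne_zero_of_lt h)]

end Symmetric

section Skew

variable {k : Type*} [Field k] {A : Type*} [Ring A] [Algebra k A] {a b p q : k} {y : Fin 3 → A}
  {D : Fin 3 → A →ₗ[k] A}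

theorem SkewCalculus.skew_two_two (hD : SkewCalculus (coeff13 a b p q (-1)) y D)
    (hy : Algebra.adjoin k (Set.range y) = ⊤) (w : A) : D 2 (D 2 w) = 0 := by
  refine mem_of_mul_mem hy (N := LinearMap.ker (D 2 ∘ₗ D 2)) (by simp [hD.one])
    (fun j v hv => ?_) w
  simp only [LinearMap.mem_ker, LinearMap.comp_apply] at hv ⊢
  fin_cases j <;> simp [hD.map_mul13, leibniz13, hv]

theorem SkewCalculus.skew_two_one (hD : SkewCalculus (coeff13 a b p q (-1)) y D)
    (hy : Algebra.adjoin k (Set.range y) = ⊤) (w : A) : D 2 (D 1 w) = -D 1 (D 2 w) := by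
  refine mem_of_mul_mem hy (N := LinearMap.eqLocus (D 2 ∘ₗ D 1) (-(D 1 ∘ₗ D 2)))
    (by simp [hD.one]) (fun j v hv => ?_) w
  simp only [LinearMap.mem_eqLocus, LinearMap.comp_apply, LinearMap.neg_apply] at hv ⊢
  fin_cases j <;> simp [hD.map_mul13, leibniz13, hD.skew_two_two hy, hv]
  module

theorem SkewCalculus.skew_sq_pow_mul0 (hD : SkewCalculus (coeff13 a b p q (-1)) y D) (n : ℕ)
    (w : A) : ((D 1 ^ 2) ^ n) (y 0 * w) = y 0 * ((D 1 ^ 2) ^ n) w :=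
  pow_apply_mul_of_apply_mul (fun w => by simp [pow_two, hD.map_mul13, leibniz13]) n w

theorem SkewCalculus.skew_sq_pow_mul1 (hD : SkewCalculus (coeff13 a b p q (-1)) y D) (n : ℕ)
    (w : A) : ((D 1 ^ 2) ^ n) (y 1 * w) = y 1 * ((D 1 ^ 2) ^ n) w :=
  pow_apply_mul_of_apply_mul (fun w => by simp [pow_two, hD.map_mul13, leibniz13]) n w

theorem SkewCalculus.skew_two_sq_pow (hD : SkewCalculus (coeff13 a b p q (-1)) y D)
    (hy : Algebra.adjoin k (Set.range y) = ⊤) (n : ℕ) (w : A) :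
    D 2 (((D 1 ^ 2) ^ n) w) = ((D 1 ^ 2) ^ n) (D 2 w) := by
  have hcomm : Commute (D 2) (D 1 ^ 2) :=
    LinearMap.ext fun w => by simp [pow_two, hD.skew_two_one hy]
  exact LinearMap.congr_fun (hcomm.pow_right n).eq w

theorem SkewCalculus.skew_sq_pow_mul2 (hD : SkewCalculus (coeff13 a b p q (-1)) y D)
    (hy : Algebra.adjoin k (Set.range y) = ⊤) (n : ℕ) (w : A) :
    ((D 1 ^ 2) ^ (n + 1)) (y 2 * w) = -((n + 1) * q) • D 2 (((D 1 ^ 2) ^ n) w) +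
      (y 2 + (2 * (n + 1) * b) • y 0) * ((D 1 ^ 2) ^ (n + 1)) w := by
  have hsq (w : A) :
      (D 1 ^ 2) (y 2 * w) = y 2 * (D 1 ^ 2) w + (2 * b) • (y 0 * (D 1 ^ 2) w) - q • D 2 w := by
    simp [pow_two, hD.map_mul13, leibniz13, hD.skew_two_one hy]
    module
  induction n generalizing w with
  | zero =>
    simp [hsq, add_mul]
    module
  | succ n ih =>
    rw [pow_succ, Module.End.mul_apply, hsq]
    simp only [map_add, map_sub, map_smul, ih, hD.skew_sq_pow_mul0, ← Module.End.mul_apply,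
      ← pow_succ, add_mul, smul_mul_assoc]
    simp only [Module.End.mul_apply, hD.skew_two_sq_pow hy]
    push_cast
    module

theorem SkewCalculus.skew_two_sq_pow_mul2 (hD : SkewCalculus (coeff13 a b p q (-1)) y D)
    (hy : Algebra.adjoin k (Set.range y) = ⊤) (n : ℕ) (w : A) :
    D 2 (((D 1 ^ 2) ^ n) (y 2 * w)) =
      ((D 1 ^ 2) ^ n) w - (y 2 + ((2 * n + 1) * b) • y 0) * D 2 (((D 1 ^ 2) ^ n) w) := by
  have hmul0 (w : A) : D 2 (y 0 * w) = -(y 0 * D 2 w) := by simp [hD.map_mul13, leibniz13]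
  have hmul2 (w : A) : D 2 (y 2 * w) = w - y 2 * D 2 w - b • (y 0 * D 2 w) := by
    simp [hD.map_mul13, leibniz13, sub_eq_add_neg]
  cases n with
  | zero =>
    simp [hmul2, add_mul]
    abel
  | succ n =>
    rw [hD.skew_sq_pow_mul2 hy]
    simp only [add_mul, smul_mul_assoc, map_add, map_smul, hmul0, hmul2, hD.skew_two_two hy,
      smul_zero]
    push_cast
    module

/-- The leading maps for `t = -1`. As `D 2` squares to zero, it removes at most one factor `y 2`;
pairs of them are removed by `D 1 ^ 2`. -/
def skewHead (D : Fin 3 → A →ₗ[k] A) (n : ℕ) : Module.End k A := D 2 ^ (n % 2) * (D 1 ^ 2) ^ (n / 2)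

theorem skewHead_two_mul (n : ℕ) : skewHead D (2 * n) = (D 1 ^ 2) ^ n := by
  simp [skewHead]

theorem skewHead_two_mul_add_one (n : ℕ) : skewHead D (2 * n + 1) = D 2 * (D 1 ^ 2) ^ n := by
  simp [skewHead, Nat.add_mod, Nat.mul_add_div]

theorem SkewCalculus.leadingMaps_skew (hD : SkewCalculus (coeff13 a b p q (-1)) y D)
    (hy : Algebra.adjoin k (Set.range y) = ⊤) :
    LeadingMaps y D (skewHead D) (fun n => (-1) ^ n)
      (fun n => if Even n then 1 else -(((n + 1) / 2 : ℕ) * q)) where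
  zero := by simp [skewHead]
  succ_const n w hw := by
    obtain ⟨n, rfl | rfl⟩ := n.even_or_odd'
    · rw [skewHead_two_mul_add_one, Module.End.mul_apply, hD.skew_two_sq_pow hy, hw, map_zero]
    · rw [show 2 * n + 1 + 1 = 2 * (n + 1) by ring, skewHead_two_mul]
      exact end_pow_apply_eq_zero (by simp [pow_two, hw]) n.succ_ne_zero
  mul0 n w := by
    obtain ⟨n, rfl | rfl⟩ := n.even_or_odd'
    · simp [skewHead_two_mul, hD.skew_sq_pow_mul0]
    · simp [skewHead_two_mul_add_one, hD.skew_sq_pow_mul0, hD.map_mul13, leibniz13,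
        pow_succ _ (2 * n)]
  mul1 n w := by
    obtain ⟨n, rfl | rfl⟩ := n.even_or_odd'
    · simp [skewHead_two_mul, hD.skew_sq_pow_mul1]
    · simp [skewHead_two_mul_add_one, hD.skew_sq_pow_mul1, hD.map_mul13, leibniz13,
        pow_succ _ (2 * n)]
  mul2 n := by
    obtain ⟨n, rfl | rfl⟩ := n.even_or_odd'
    · refine ⟨-(y 2 + ((2 * n + 1) * b) • y 0), fun w => ?_⟩
      simp only [skewHead_two_mul_add_one, skewHead_two_mul, Module.End.mul_apply,
        hD.skew_two_sq_pow_mul2 hy, even_two_mul, if_true, one_smul, neg_mul, sub_eq_add_neg]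
    · refine ⟨y 2 + (2 * (n + 1) * b) • y 0, fun w => ?_⟩
      have hhalf : (2 * n + 1 + 1) / 2 = n + 1 := by omega
      rw [if_neg (by simp), hhalf, skewHead_two_mul_add_one,
        show 2 * n + 1 + 1 = 2 * (n + 1) by ring, skewHead_two_mul, hD.skew_sq_pow_mul2 hy]
      push_cast
      rfl

theorem SkewCalculus.skew_pow_map_pow (hD : SkewCalculus (coeff13 a b p q (-1)) y D)
    {ε : A →ₐ[k] k} (hε : ∀ j, ε (y j) = 0) {m n i j : ℕ} (hm : m < 2) (hn : n < 2) (hi : i < 2)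
    (hj : j < 2) : ε ((D 0 ^ m * D 1 ^ n) (y 0 ^ i * y 1 ^ j)) =
      if i = m ∧ j = n then (-1) ^ (m * n) else 0 := by
  have hone (l j : Fin 3) : D l (y j) = if l = j then 1 else 0 := by
    rw [← mul_one (y j), hD.mul]
    simp [hD.one]
  interval_cases m <;> interval_cases n <;> interval_cases i <;> interval_cases j <;>
    simp [hε, hone, hD.one, hD.map_mul13, leibniz13]

theorem SkewCalculus.hasTriangularFunctionals_skew [CharZero k]
    (hD : SkewCalculus (coeff13 a b p q (-1)) y D) (hy : Algebra.adjoin k (Set.range y) = ⊤)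
    {ε : A →ₐ[k] k} (hε : ∀ j, ε (y j) = 0) {S : Set (ℕ × ℕ × ℕ)} (h0 : 0 ∈ S)
    (hS : ∀ e ∈ S, e.1 < 2 ∧ e.2.1 < 2 ∧ (q ≠ 0 ∨ e.2.2 < 2)) :
    HasTriangularFunctionals (fun e : S => mon y e) (fun e => e.1.2.2)
      (⨅ m, LinearMap.ker (D m)) ⟨0, h0⟩ := by
  refine (hD.leadingMaps_skew hy).hasTriangularFunctionals (ε := ε.toLinearMap) hD.one (by simp) h0
    (fun e he => Finset.prod_ne_zero_iff.2 fun i hi => ?_) (fun e he => ?_)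
    fun e he e' he' hne => ?_
  · split_ifs with heven
    · exact one_ne_zero
    · have hpos : 0 < (i + 1) / 2 := Nat.div_pos (by grind) two_pos
      have hq : q ≠ 0 := (hS e he).2.2.resolve_right (by grind)
      exact neg_ne_zero.2 (mul_ne_zero (Nat.cast_ne_zero.2 hpos.ne') hq)
  · obtain ⟨he₁, he₂, -⟩ := hS e he
    rw [AlgHom.toLinearMap_apply, hD.skew_pow_map_pow hε he₁ he₂ he₁ he₂, if_pos ⟨rfl, rfl⟩]
    simp
  · obtain ⟨he₁, he₂, -⟩ := hS e he
    obtain ⟨he'₁, he'₂, -⟩ := hS e' he'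
    rw [AlgHom.toLinearMap_apply, hD.skew_pow_map_pow hε he₁ he₂ he'₁ he'₂,
      if_neg fun h => hne h.1 h.2]

end Skew

/-! ### Polynomial growth -/

section Growth

open Filter Asymptotics

theorem tendsto_add_div_log (d C : ℝ) :
    Tendsto (fun n : ℕ => ((d + C / Real.log n : ℝ) : EReal)) atTop (nhds (d : EReal)) := by
  have h : Tendsto (fun n : ℕ => C / Real.log n) atTop (nhds 0) :=
    (Real.tendsto_log_atTop.comp tendsto_natCast_atTop_atTop).const_div_atTop C
  exact (continuous_coe_real_ereal.tendsto d).comp (by simpa using h.const_add d)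

theorem limsup_log_div_log_le {f : ℕ → ℝ} {d : ℕ} (hf : f =O[atTop] fun n => (n : ℝ) ^ d) :
    limsup (fun n : ℕ => ((Real.log (f n) / Real.log n : ℝ) : EReal)) atTop ≤ d := by
  obtain ⟨C, hC, hf⟩ := hf.exists_pos
  rw [← EReal.coe_natCast, ← (tendsto_add_div_log d (Real.log (max C 1))).limsup_eq]
  refine limsup_le_limsup ?_
  filter_upwards [hf.bound, eventually_ge_atTop 2] with n hn h2
  have h2 : (1 : ℝ) < n := by exact_mod_cast h2
  have hlog : 0 < Real.log n := Real.log_pos h2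
  have hmax : ‖f n‖ ≤ max C 1 * (n : ℝ) ^ d := by
    rw [norm_pow, Real.norm_natCast] at hn
    exact hn.trans (by gcongr; exact le_max_left C 1)
  have hle : Real.log (f n) ≤ Real.log (max C 1) + d * Real.log n := by
    rw [← Real.log_pow, ← Real.log_mul (by positivity) (by positivity), ← Real.log_abs (f n)]
    rcases (abs_nonneg (f n)).eq_or_lt with h0 | h0
    · rw [← h0, Real.log_zero]
      exact Real.log_nonneg (one_le_mul_of_one_le_of_one_le (le_max_right C 1) (one_le_pow₀ h2.le))
    · exact Real.log_le_log h0 hmax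
  rw [EReal.coe_le_coe_iff, div_le_iff₀ hlog, add_mul, div_mul_cancel₀ _ hlog.ne']
  linarith

theorem le_limsup_log_div_log {f : ℕ → ℝ} {d : ℕ} (hf : (fun n : ℕ => (n : ℝ) ^ d) =O[atTop] f) :
    d ≤ limsup (fun n : ℕ => ((Real.log (f n) / Real.log n : ℝ) : EReal)) atTop := by
  obtain ⟨C, hC, hf⟩ := hf.exists_pos
  rw [← EReal.coe_natCast, ← (tendsto_add_div_log d (-Real.log C)).limsup_eq]
  refine limsup_le_limsup ?_
  filter_upwards [hf.bound, eventually_ge_atTop 2] with n hn h2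
  have h2 : (1 : ℝ) < n := by exact_mod_cast h2
  have hlog : 0 < Real.log n := Real.log_pos h2
  rw [norm_pow, Real.norm_natCast, Real.norm_eq_abs] at hn
  have hpos : 0 < |f n| := pos_of_mul_pos_right (lt_of_lt_of_le (by positivity) hn) hC.le
  have hle : d * Real.log n ≤ Real.log C + Real.log (f n) := by
    rw [← Real.log_pow, ← Real.log_abs (f n), ← Real.log_mul hC.ne' hpos.ne']
    exact Real.log_le_log (by positivity) hn
  rw [EReal.coe_le_coe_iff, le_div_iff₀ hlog, add_mul, div_mul_cancel₀ _ hlog.ne']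
  linarith

variable {k A : Type*} [Field k] [Ring A] [Algebra k A] {W : Submodule k A}

theorem exists_mem_one_sup_pow (hgen : Algebra.adjoin k (W : Set A) = ⊤) (w : A) :
    ∃ n, w ∈ (1 ⊔ W) ^ n := by
  have hmono : Monotone fun n => (1 ⊔ W) ^ n := pow_right_mono₀ le_sup_left
  induction (hgen ▸ Algebra.mem_top : w ∈ Algebra.adjoin k (W : Set A)) using
    Algebra.adjoin_induction with
  | mem w hw => exact ⟨1, by simpa using Submodule.mem_sup_right hw⟩
  | algebraMap r => exact ⟨0, by simp⟩
  | add u v _ _ hu hv =>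
    obtain ⟨⟨m, hm⟩, ⟨n, hn⟩⟩ := hu, hv
    exact ⟨max m n, add_mem (hmono (le_max_left m n) hm) (hmono (le_max_right m n) hn)⟩
  | mul u v _ _ hu hv =>
    obtain ⟨⟨m, hm⟩, ⟨n, hn⟩⟩ := hu, hv
    exact ⟨m + n, pow_add (1 ⊔ W) m n ▸ Submodule.mul_mem_mul hm hn⟩

theorem exists_le_one_sup_pow (hgen : Algebra.adjoin k (W : Set A) = ⊤) {U : Submodule k A}
    (hU : U.FG) : ∃ n, U ≤ (1 ⊔ W) ^ (n + 1) := by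
  obtain ⟨s, rfl⟩ := hU
  choose f hf using exists_mem_one_sup_pow hgen
  refine ⟨s.sup f, Submodule.span_le.2 fun w hw => ?_⟩
  have hmono : Monotone fun n => (1 ⊔ W) ^ n := pow_right_mono₀ le_sup_left
  exact hmono ((Finset.le_sup hw).trans (Nat.le_succ _)) (hf w)

theorem gkDim_eq_of_growth (hW : W.FG) (hgen : Algebra.adjoin k (W : Set A) = ⊤) {d : ℕ}
    (h : (fun n : ℕ => (Module.finrank k ↥((1 ⊔ W) ^ n) : ℝ)) =Θ[atTop] fun n => (n : ℝ) ^ d) :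
    gkDim k A = d := by
  rw [gkDim]
  refine le_antisymm (iSup_le fun ⟨U, hU⟩ => limsup_log_div_log_le ?_)
    (le_iSup_of_le ⟨W, hW⟩ (le_limsup_log_div_log h.2))
  obtain ⟨m, hm⟩ := exists_le_one_sup_pow hgen hU
  have hfin (n : ℕ) : Module.Finite k ↥((1 ⊔ W) ^ n) := by
    refine Module.Finite.iff_fg.2 (.pow (.sup ?_ hW) n)
    rw [Submodule.one_eq_span]
    exact Submodule.fg_span_singleton 1
  have hle (n : ℕ) : (1 ⊔ U) ^ n ≤ (1 ⊔ W) ^ ((m + 1) * n) := by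
    rw [pow_mul]
    exact pow_le_pow_left₀ bot_le (sup_le (one_le_pow₀ le_sup_left) hm) n
  have hlin : Tendsto (fun n => (m + 1) * n) atTop atTop := tendsto_id.const_mul_atTop' m.succ_pos
  calc (fun n => (Module.finrank k ↥((1 ⊔ U) ^ n) : ℝ))
      =O[atTop] fun n => (Module.finrank k ↥((1 ⊔ W) ^ ((m + 1) * n)) : ℝ) :=
        .of_norm_le fun n => by simpa using Submodule.finrank_mono (hle n)
    _ =O[atTop] fun n => (((m + 1) * n : ℕ) : ℝ) ^ d := h.1.comp_tendsto hlin
    _ =O[atTop] fun n => (n : ℝ) ^ d := by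
        simp only [Nat.cast_mul, mul_pow]
        exact isBigO_const_mul_self _ _ _

end Growth

/-! ### Straightening of monomials -/

section MonSpan

open Filter Asymptotics

variable {k A : Type*} [Field k] [Ring A] [Algebra k A]

/-- The exponents in `S` of total degree at most `n`. -/
def expLE (S : Set (ℕ × ℕ × ℕ)) (n : ℕ) : Set (ℕ × ℕ × ℕ) :=
  {e | e ∈ S ∧ e.1 + e.2.1 + e.2.2 ≤ n}

variable (k) in
/-- The span of the monomials with exponents in `S` of total degree at most `n`. -/
def monSpan (y : Fin 3 → A) (S : Set (ℕ × ℕ × ℕ)) (n : ℕ) : Submodule k A :=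
  Submodule.span k (mon y '' expLE S n)

variable (k) in
/-- Products `y j * mon y e` can be rewritten in the monomials with exponents in `S` without
raising the degree: left multiplication by `y j` maps `monSpan k y S n` into
`monSpan k y S (n + 1)`. -/
structure IsStraightening (y : Fin 3 → A) (S : Set (ℕ × ℕ × ℕ)) : Prop where
  zero_mem : 0 ∈ S
  mul_mon_mem : ∀ j, ∀ e ∈ S, y j * mon y e ∈ monSpan k y S (e.1 + e.2.1 + e.2.2 + 1)

variable {y : Fin 3 → A} {S : Set (ℕ × ℕ × ℕ)}

theorem mon_mem_monSpan {e : ℕ × ℕ × ℕ} (he : e ∈ S) {n : ℕ} (hn : e.1 + e.2.1 + e.2.2 ≤ n) :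
    mon y e ∈ monSpan k y S n :=
  Submodule.subset_span ⟨e, ⟨he, hn⟩, rfl⟩

theorem monSpan_mono : Monotone (monSpan k y S) := fun _ _ h =>
  Submodule.span_mono (Set.image_mono fun _ he => ⟨he.1, he.2.trans h⟩)

theorem expLE_finite (S : Set (ℕ × ℕ × ℕ)) (n : ℕ) : (expLE S n).Finite :=
  (Set.finite_Iic ((n, n, n) : ℕ × ℕ × ℕ)).subset fun e ⟨_, he⟩ =>
    ⟨by simp only; omega, by simp only; omega, by simp only; omega⟩

namespace IsStraightening

theorem one_mem (h : IsStraightening k y S) : 1 ∈ monSpan k y S 0 := by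
  simpa [mon] using mon_mem_monSpan (k := k) (y := y) h.zero_mem le_rfl

theorem mul_mem (h : IsStraightening k y S) (j : Fin 3) {n : ℕ} {w : A}
    (hw : w ∈ monSpan k y S n) : y j * w ∈ monSpan k y S (n + 1) := by
  have hle : monSpan k y S n ≤ (monSpan k y S (n + 1)).comap (LinearMap.mulLeft k (y j)) := by
    refine Submodule.span_le.2 ?_
    rintro _ ⟨e, he, rfl⟩
    exact monSpan_mono (Nat.add_le_add_right he.2 1) (h.mul_mon_mem j e he.1)
  exact hle hw

theorem pow_le_monSpan (h : IsStraightening k y S) (n : ℕ) :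
    (1 ⊔ Submodule.span k (Set.range y)) ^ n ≤ monSpan k y S n := by
  induction n with
  | zero => rw [pow_zero, Submodule.one_le]; exact h.one_mem
  | succ n ih =>
    rw [pow_succ', Submodule.sup_mul, one_mul]
    refine sup_le (ih.trans (monSpan_mono n.le_succ)) (Submodule.mul_le.2 fun u hu w hw => ?_)
    have hle : Submodule.span k (Set.range y) ≤
        (monSpan k y S (n + 1)).comap (LinearMap.mulRight k w) := by
      refine Submodule.span_le.2 ?_
      rintro _ ⟨j, rfl⟩
      exact h.mul_mem j (ih hw)
    exact hle hu

theorem pow_eq_monSpan (h : IsStraightening k y S) (n : ℕ) :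
    (1 ⊔ Submodule.span k (Set.range y)) ^ n = monSpan k y S n := by
  refine le_antisymm (h.pow_le_monSpan n) (Submodule.span_le.2 ?_)
  rintro _ ⟨e, he, rfl⟩
  have hy (j : Fin 3) (i : ℕ) : y j ^ i ∈ (1 ⊔ Submodule.span k (Set.range y)) ^ i :=
    Submodule.pow_mem_pow _
      (Submodule.mem_sup_right (Submodule.subset_span (Set.mem_range_self j))) i
  have hmono : Monotone fun i => (1 ⊔ Submodule.span k (Set.range y)) ^ i :=
    pow_right_mono₀ le_sup_left
  refine hmono he.2 ?_
  simp only [pow_add]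
  exact Submodule.mul_mem_mul (Submodule.mul_mem_mul (hy 0 _) (hy 1 _)) (hy 2 _)

theorem span_eq_top (h : IsStraightening k y S) (hy : Algebra.adjoin k (Set.range y) = ⊤) :
    Submodule.span k (Set.range fun e : S => mon y e) = ⊤ := by
  refine eq_top_iff.2 fun w _ => ?_
  obtain ⟨n, hn⟩ := exists_mem_one_sup_pow (W := Submodule.span k (Set.range y))
    (by rw [Algebra.adjoin_span, hy]) w
  refine Submodule.span_mono ?_ (h.pow_le_monSpan n hn)
  rintro _ ⟨e, he, rfl⟩
  exact ⟨⟨e, he.1⟩, rfl⟩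

theorem finrank_pow (h : IsStraightening k y S)
    (hli : LinearIndependent k (fun e : S => mon y e)) (n : ℕ) :
    Module.finrank k ↥((1 ⊔ Submodule.span k (Set.range y)) ^ n) = (expLE S n).ncard := by
  have hli' : LinearIndependent k (fun e : expLE S n => mon y e) :=
    hli.comp (Set.inclusion fun _ he => he.1) (Set.inclusion_injective _)
  have := (expLE_finite S n).fintype
  rw [h.pow_eq_monSpan, monSpan, Set.image_eq_range, finrank_span_eq_card hli',
    Set.ncard_eq_toFinset_card', Set.toFinset_card]

theorem gkDim_eq (h : IsStraightening k y S) (hy : Algebra.adjoin k (Set.range y) = ⊤)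
    (hli : LinearIndependent k (fun e : S => mon y e)) {d : ℕ}
    (hS : (fun n => ((expLE S n).ncard : ℝ)) =Θ[atTop] fun n => (n : ℝ) ^ d) : gkDim k A = d := by
  refine gkDim_eq_of_growth (W := Submodule.span k (Set.range y))
    (Submodule.fg_span (Set.finite_range y)) (by rw [Algebra.adjoin_span, hy]) ?_
  simpa only [h.finrank_pow hli] using hS

theorem of_mul_mon (h0 : 0 ∈ S)
    (h1 : ∀ i j c, ∃ r : k, y 1 * mon y (i, j, c) = r • mon y (i, j + 1, c))
    (h2 : ∀ i j c, ∃ r s : k,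
      y 2 * mon y (i, j, c) = r • mon y (i, j, c + 1) + s • mon y (i + 1, j, c))
    (hS : ∀ i j c, (i, j, c) ∈ S → mon y (i + 1, j, c) ∈ monSpan k y S (i + j + c + 1) ∧
      mon y (i, j + 1, c) ∈ monSpan k y S (i + j + c + 1) ∧
      mon y (i, j, c + 1) ∈ monSpan k y S (i + j + c + 1)) : IsStraightening k y S where
  zero_mem := h0
  mul_mon_mem := by
    rintro m ⟨i, j, c⟩ he
    obtain ⟨hi, hj, hc⟩ := hS i j c he
    fin_cases m
    · have hmul : y 0 * mon y (i, j, c) = mon y (i + 1, j, c) := by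
        simp [mon, pow_succ', mul_assoc]
      simpa [hmul] using hi
    · obtain ⟨r, hr⟩ := h1 i j c
      simpa [hr] using Submodule.smul_mem _ r hj
    · obtain ⟨r, s, hrs⟩ := h2 i j c
      simpa [hrs] using add_mem (Submodule.smul_mem _ r hc) (Submodule.smul_mem _ s hi)

theorem map {B : Type*} [Ring B] [Algebra k B] (h : IsStraightening k y S) (g : A →ₐ[k] B) :
    IsStraightening k (fun j => g (y j)) S where
  zero_mem := h.zero_mem
  mul_mon_mem j e he := by
    have hmem := Submodule.mem_map_of_mem (f := g.toLinearMap) (h.mul_mon_mem j e he)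
    simpa [monSpan, Submodule.map_span, Set.image_image, map_mon] using hmem

end IsStraightening

variable {a b p : k}

theorem SymmRel.two_mul_pow_zero (h : SymmRel a b y) (i : ℕ) :
    y 2 * y 0 ^ i = y 0 ^ i * y 2 + (i * a) • y 0 ^ (i + 1) := by
  induction i with
  | zero => simp
  | succ i ih =>
    rw [pow_succ', h.swap20_assoc, ih, mul_add, mul_smul_comm, ← pow_succ', ← pow_succ',
      ← pow_succ', ← mul_assoc, ← pow_succ']
    push_cast
    module

theorem SymmRel.two_mul_pow_one (h : SymmRel a b y) (j : ℕ) :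
    y 2 * y 1 ^ j = y 1 ^ j * y 2 + (j * b) • (y 0 * y 1 ^ j) := by
  induction j with
  | zero => simp
  | succ j ih =>
    rw [pow_succ', h.swap21_assoc, ih, mul_add, mul_smul_comm, h.swap10_assoc, mul_assoc]
    push_cast
    module

theorem SymmRel.isStraightening (h : SymmRel a b y) : IsStraightening k y B3 := by
  refine .of_mul_mon trivial (fun i j c => ⟨1, ?_⟩) (fun i j c => ⟨1, i * a + j * b, ?_⟩)
    fun i j c _ => ⟨mon_mem_monSpan (Set.mem_univ _) ?_, mon_mem_monSpan (Set.mem_univ _) ?_,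
      mon_mem_monSpan (Set.mem_univ _) ?_⟩
  · have hpow : y 1 * y 0 ^ i = y 0 ^ i * y 1 := (Commute.pow_right h.swap10 i).eq
    simp only [mon, ← mul_assoc, hpow, one_smul]
    simp only [pow_succ', mul_assoc]
  · simp only [mon, ← mul_assoc, h.two_mul_pow_zero, add_mul]
    rw [mul_assoc _ (y 2), h.two_mul_pow_one]
    simp only [mul_add, mul_smul_comm, smul_mul_assoc, add_mul, add_smul, one_smul,
      pow_succ' (y 2), pow_succ (y 0), mul_assoc]
    abel
  all_goals simp only; omega

theorem SkewRel.mon_eq_zero (h : SkewRel b y) {i j c : ℕ} (hij : 2 ≤ i ∨ 2 ≤ j) :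
    mon y (i, j, c) = 0 := by
  obtain hi | hj := hij
  · simp [mon, pow_eq_zero_of_le hi ((pow_two _).trans h.sq0)]
  · simp [mon, pow_eq_zero_of_le hj ((pow_two _).trans h.sq1)]

theorem SkewRel.mon_mem_monSpan (h : SkewRel b y) {i j c n : ℕ}
    (hS : i < 2 → j < 2 → (i, j, c) ∈ S) (hn : i + j + c ≤ n) :
    mon y (i, j, c) ∈ monSpan k y S n := by
  by_cases hij : i < 2 ∧ j < 2
  · exact Nichols.mon_mem_monSpan (hS hij.1 hij.2) hn
  · rw [h.mon_eq_zero (by omega)]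
    exact zero_mem _

theorem SkewRel.one_mul_pow_zero (h : SkewRel b y) (i : ℕ) :
    y 1 * y 0 ^ i = (-1 : k) ^ i • (y 0 ^ i * y 1) := by
  induction i with
  | zero => simp
  | succ i ih =>
    rw [pow_succ', h.swap10_assoc, ih, mul_smul_comm, pow_succ', mul_smul, neg_one_smul, mul_assoc]

theorem SkewRel.one_mul_mon (h : SkewRel b y) (i j c : ℕ) :
    y 1 * mon y (i, j, c) = (-1 : k) ^ i • mon y (i, j + 1, c) := by
  simp only [mon, ← mul_assoc, h.one_mul_pow_zero, smul_mul_assoc]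
  simp only [pow_succ', mul_assoc]

theorem SkewRel.two_mul_mon (h : SkewRel b y) (i j c : ℕ) :
    y 2 * mon y (i, j, c) =
      (-1 : k) ^ (i + j) • mon y (i, j, c + 1) + ((-1) ^ i * j * b) • mon y (i + 1, j, c) := by
  induction i with
  | zero =>
    obtain hj | hj := lt_or_ge j 2
    · interval_cases j <;> simp [mon, pow_succ', mul_assoc, h.swap21_assoc]
      abel
    · simp [mon, pow_eq_zero_of_le hj ((pow_two _).trans h.sq1)]
  | succ i ih =>
    have hmul (j c : ℕ) (i : ℕ) : y 0 * mon y (i, j, c) = mon y (i + 1, j, c) := by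
      simp [mon, pow_succ', mul_assoc]
    rw [← hmul, h.swap20_assoc, ih, mul_add, mul_smul_comm, mul_smul_comm, hmul, hmul,
      add_right_comm]
    module

theorem SkewRel.isStraightening_of_mem (h : SkewRel b y) (h0 : 0 ∈ S)
    (hS : ∀ i j c, (i, j, c) ∈ S → mon y (i + 1, j, c) ∈ monSpan k y S (i + j + c + 1) ∧
      mon y (i, j + 1, c) ∈ monSpan k y S (i + j + c + 1) ∧
      mon y (i, j, c + 1) ∈ monSpan k y S (i + j + c + 1)) : IsStraightening k y S :=
  .of_mul_mon h0 (fun i j c => ⟨_, h.one_mul_mon i j c⟩)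
    (fun i j c => ⟨_, _, h.two_mul_mon i j c⟩) hS

theorem SkewRel.isStraightening (h : SkewRel b y) : IsStraightening k y B1 := by
  have hmem {i j c n : ℕ} : i + j + c ≤ n → mon y (i, j, c) ∈ monSpan k y B1 n :=
    h.mon_mem_monSpan fun hi hj => ⟨hi, hj⟩
  exact h.isStraightening_of_mem (by simp [B1]) fun i j c _ =>
    ⟨hmem (by omega), hmem (by omega), hmem (by omega)⟩

theorem ExtRel.mon_two (h : ExtRel b p y) (i j : ℕ) :
    mon y (i, j, 2) = ((-1) ^ j * b) • mon y (i + 1, j, 1) +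
      ((-1) ^ j * p) • mon y (i + 1, j + 1, 0) := by
  have hcomm : y 1 ^ j * y 0 = (-1 : k) ^ j • (y 0 * y 1 ^ j) := by
    induction j with
    | zero => simp
    | succ j ih =>
      rw [pow_succ', mul_assoc, ih, mul_smul_comm, h.swap10_assoc, pow_succ', mul_smul,
        neg_one_smul, smul_neg]
  rw [mon, mul_assoc, pow_two, h.sq2, mul_add, mul_smul_comm, mul_smul_comm, ← mul_assoc (y 1 ^ j),
    ← mul_assoc (y 1 ^ j), hcomm]
  simp only [mon, mul_add, mul_smul_comm, smul_mul_assoc, smul_smul, mul_assoc, pow_succ, pow_zero,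
    one_mul, mul_one, mul_comm b, mul_comm p]

theorem ExtRel.mon_mem_monSpan (h : ExtRel b p y) {i j c n : ℕ} (hc : c ≤ 2)
    (hn : i + j + c ≤ n) : mon y (i, j, c) ∈ monSpan k y B0 n := by
  have hmem {i j c : ℕ} (hc : c < 2) : i + j + c ≤ n → mon y (i, j, c) ∈ monSpan k y B0 n :=
    h.toSkewRel.mon_mem_monSpan fun hi hj => ⟨hi, hj, hc⟩
  obtain hc | rfl := hc.lt_or_eq
  · exact hmem hc hn
  · rw [h.mon_two]
    exact add_mem (Submodule.smul_mem _ _ (hmem one_lt_two (by omega)))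
      (Submodule.smul_mem _ _ (hmem two_pos (by omega)))

theorem ExtRel.isStraightening (h : ExtRel b p y) : IsStraightening k y B0 := by
  refine h.toSkewRel.isStraightening_of_mem (by simp [B0]) fun i j c he => ?_
  have hc : c < 2 := he.2.2
  exact ⟨h.mon_mem_monSpan (by omega) (by omega), h.mon_mem_monSpan (by omega) (by omega),
    h.mon_mem_monSpan (by omega) (by omega)⟩

/-! ### Counting exponents -/

theorem mul_le_ncard_expLE {l m r n : ℕ} (hS : ∀ i < l, ∀ j < m, ∀ c < r, (i, j, c) ∈ S)
    (hn : l + m + r ≤ n + 3) : l * (m * r) ≤ (expLE S n).ncard := by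
  let box : Finset (ℕ × ℕ × ℕ) := Finset.range l ×ˢ Finset.range m ×ˢ Finset.range r
  have hcard : box.card = l * (m * r) := by simp [box]
  rw [← hcard, ← Set.ncard_coe_finset]
  refine Set.ncard_le_ncard (fun ⟨i, j, c⟩ he => ?_) (expLE_finite S n)
  simp only [box, Finset.mem_coe, Finset.mem_product, Finset.mem_range] at he
  exact ⟨hS i he.1 j he.2.1 c he.2.2, by simp only; omega⟩

theorem ncard_expLE_le {l m r n : ℕ}
    (hS : ∀ i j c, (i, j, c) ∈ S → i + j + c ≤ n → i < l ∧ j < m ∧ c < r) :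
    (expLE S n).ncard ≤ l * (m * r) := by
  let box : Finset (ℕ × ℕ × ℕ) := Finset.range l ×ˢ Finset.range m ×ˢ Finset.range r
  have hcard : box.card = l * (m * r) := by simp [box]
  rw [← hcard, ← Set.ncard_coe_finset]
  refine Set.ncard_le_ncard (fun ⟨i, j, c⟩ he => ?_) box.finite_toSet
  simpa [box] using hS i j c he.1 he.2

theorem isTheta_pow_of_le {f : ℕ → ℕ} {d C C' : ℕ} (hlow : ∀ n, n ^ d ≤ C * f n)
    (hupp : ∀ n ≠ 0, f n ≤ C' * n ^ d) :
    (fun n => (f n : ℝ)) =Θ[atTop] fun n => (n : ℝ) ^ d := by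
  refine ⟨.of_bound C' ?_, .of_bound C (.of_forall fun n => ?_)⟩
  · filter_upwards [eventually_ne_atTop 0] with n hn
    simpa using mod_cast hupp n hn
  · simpa using mod_cast hlow n

theorem isTheta_ncard_expLE_B3 :
    (fun n => ((expLE B3 n).ncard : ℝ)) =Θ[atTop] fun n => (n : ℝ) ^ 3 := by
  refine isTheta_pow_of_le (C := 27) (C' := 8) (fun n => ?_) fun n hn => ?_
  · calc n ^ 3 ≤ (3 * (n / 3 + 1)) ^ 3 := by gcongr; omega
      _ = 27 * ((n / 3 + 1) * ((n / 3 + 1) * (n / 3 + 1))) := by ring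
      _ ≤ 27 * (expLE B3 n).ncard := by
        gcongr
        exact mul_le_ncard_expLE (fun _ _ _ _ _ _ => trivial) (by omega)
  · calc (expLE B3 n).ncard ≤ (n + 1) * ((n + 1) * (n + 1)) := ncard_expLE_le (by omega)
      _ = (n + 1) ^ 3 := by ring
      _ ≤ (2 * n) ^ 3 := by gcongr; omega
      _ = 8 * n ^ 3 := by ring

theorem isTheta_ncard_expLE_B1 :
    (fun n => ((expLE B1 n).ncard : ℝ)) =Θ[atTop] fun n => (n : ℝ) ^ 1 := by
  refine isTheta_pow_of_le (C := 1) (C' := 8) (fun n => ?_) fun n hn => ?_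
  · have := mul_le_ncard_expLE (S := B1) (l := 1) (m := 1) (r := n + 1) (n := n)
      (fun i hi j hj c _ => ⟨by simp only; omega, by simp only; omega⟩) (by omega)
    simp only [pow_one]
    omega
  · have := ncard_expLE_le (S := B1) (l := 2) (m := 2) (r := n + 1) (n := n)
      fun i j c he _ => ⟨he.1, he.2, by omega⟩
    simp only [pow_one]
    omega

theorem isTheta_ncard_expLE_B0 :
    (fun n => ((expLE B0 n).ncard : ℝ)) =Θ[atTop] fun n => (n : ℝ) ^ 0 := by
  refine isTheta_pow_of_le (C := 1) (C' := 8) (fun n => ?_) fun n _ => ?_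
  · have := mul_le_ncard_expLE (S := B0) (l := 1) (m := 1) (r := 1) (n := n)
      (fun i hi j hj c hc => ⟨by simp only; omega, by simp only; omega, by simp only; omega⟩)
      (by omega)
    simpa using this
  · simpa using ncard_expLE_le (S := B0) (l := 2) (m := 2) (r := 2) (n := n) fun _ _ _ he _ => he

theorem ncard_B0 : B0.ncard = 8 := by
  have hB0 : B0 = ((Finset.range 2 ×ˢ Finset.range 2 ×ˢ Finset.range 2 :
      Finset (ℕ × ℕ × ℕ)) : Set (ℕ × ℕ × ℕ)) := by
    ext
    simp [B0]
  rw [hB0, Set.ncard_coe_finset]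
  rfl

end MonSpan

/-! ### Quadratic relations -/

section Quadratic

variable {k V ι : Type*} [Field k] [AddCommGroup V] [Module k V] [Fintype ι]

theorem exists_eq_sum_of_mem_relations_two {c : Braiding k V} (e : Module.Basis ι k V)
    {u : TensorAlgebra k V} (hu : u ∈ relations c 2) :
    ∃ μ : ι → ι → k, u = ∑ i, ∑ j, μ i j • (TensorAlgebra.ι k (e i) * TensorAlgebra.ι k (e j)) := by
  obtain ⟨v, -, rfl⟩ := hu
  obtain ⟨z, rfl⟩ := (pairEquiv k V).surjective v
  refine ⟨fun i j => (e.tensorProduct e).repr z (i, j), ?_⟩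
  conv_lhs => rw [← (e.tensorProduct e).sum_repr z, Fintype.sum_prod_type]
  simp [Module.Basis.tensorProduct_apply]

variable {c : Braiding k V} {e : Module.Basis ι k V} {C : ι → ι → ι → ι → k}

theorem skewDeriv_ι_mul_ι [DecidableEq ι] (m i j : ι) :
    skewDeriv e C m (TensorAlgebra.ι k (e i) * TensorAlgebra.ι k (e j)) =
      TensorAlgebra.ι k ((if m = i then e j else 0) + ∑ l, C i j m l • e l) := by
  have hD := skewCalculus_skewDeriv e C
  have hι (i j : ι) : skewDeriv e C i (TensorAlgebra.ι k (e j)) = if i = j then 1 else 0 := by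
    simpa [hD.one] using hD.mul i j 1
  rw [hD.mul, Finset.sum_eq_single j (fun n _ hn => by simp [hι, hn]) (by simp), map_add, map_sum,
    apply_ite (TensorAlgebra.ι k), map_zero]
  simp [hι]

theorem coord_add_sum_eq_zero (hC : c.HasCoeffs e C) {μ : ι → ι → k}
    (h : ∑ i, ∑ j, μ i j • (TensorAlgebra.ι k (e i) * TensorAlgebra.ι k (e j)) ∈ relations c 2)
    (m l : ι) : μ m l + ∑ i, ∑ j, μ i j * C i j m l = 0 := by
  classical
  have hu : TensorPower.toTensorAlgebra (pairEquiv k V (∑ i, ∑ j, μ i j • (e i ⊗ₜ[k] e j))) =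
      ∑ i, ∑ j, μ i j • (TensorAlgebra.ι k (e i) * TensorAlgebra.ι k (e j)) := by
    simp
  have hder : ∑ i, ∑ j, μ i j • ((if m = i then e j else 0) + ∑ l, C i j m l • e l) = 0 := by
    have hm := (mem_relations_succ hC _).1 (hu ▸ h) m
    rw [relations_one, Submodule.mem_bot, hu] at hm
    rw [← TensorAlgebra.ι_eq_zero_iff (R := k), ← hm]
    simp only [map_sum, map_smul, skewDeriv_ι_mul_ι]
  simpa [Finsupp.single_apply, ite_and, Finset.sum_add_distrib, mul_add, apply_ite] using
    congrArg (e.coord l) hder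

variable {a b p q t : k}

theorem sum_coeff13 (a b p q t : k) (μ : Fin 3 → Fin 3 → k) (m l : Fin 3) :
    ∑ i, ∑ j, μ i j * coeff13 a b p q t i j m l =
      !![t * μ 0 0 + t * a * μ 2 0 - t * a * μ 0 2 - t * a * b * μ 2 2,
          t * μ 1 0 - t * b * μ 1 2 - t * p * μ 2 2, t * μ 2 0 - t * b * μ 2 2;
        t * μ 0 1 + t * b * μ 2 1 + t * p * μ 2 2, t * μ 1 1 + t * q * μ 2 2, t * μ 2 1;
        t * μ 0 2 + t * b * μ 2 2, t * μ 1 2, t * μ 2 2] m l := by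
  have hval (m l : Fin 3) : (finProdFinEquiv (m, l) : Fin 9) = ⟨l + 3 * m, by omega⟩ := rfl
  fin_cases m <;> fin_cases l <;>
  · simp [Fin.sum_univ_three, coeff13, hval, R13]
    try ring

theorem eq_zero_of_add_sum_coeff13_eq_zero (ht : t ^ 2 ≠ 1) {μ : Fin 3 → Fin 3 → k}
    (h : ∀ m l, μ m l + ∑ i, ∑ j, μ i j * coeff13 a b p q t i j m l = 0) : μ = 0 := by
  simp only [sum_coeff13] at h
  have hpair {r s : k} (hrs : r + t * s = 0) (hsr : s + t * r = 0) : r = 0 ∧ s = 0 := by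
    have hsq : 1 - t ^ 2 ≠ 0 := sub_ne_zero.2 ht.symm
    exact ⟨(mul_eq_zero.1 (by linear_combination hrs - t * hsr)).resolve_left hsq,
      (mul_eq_zero.1 (by linear_combination hsr - t * hrs)).resolve_left hsq⟩
  obtain ⟨h22, -⟩ := hpair (h 2 2) (h 2 2)
  obtain ⟨h12, h21⟩ := hpair (h 1 2) (h 2 1)
  have h11 : μ 1 1 + t * μ 1 1 = 0 := by simpa [h22] using h 1 1
  have h02 : μ 0 2 + t * μ 2 0 = 0 := by simpa [h22] using h 0 2
  have h20 : μ 2 0 + t * μ 0 2 = 0 := by simpa [h22] using h 2 0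
  have h01 : μ 0 1 + t * μ 1 0 = 0 := by simpa [h22, h12] using h 0 1
  have h10 : μ 1 0 + t * μ 0 1 = 0 := by simpa [h22, h21] using h 1 0
  obtain ⟨h11, -⟩ := hpair h11 h11
  obtain ⟨h02, h20⟩ := hpair h02 h20
  obtain ⟨h01, h10⟩ := hpair h01 h10
  have h00 : μ 0 0 + t * μ 0 0 = 0 := by simpa [h22, h02, h20] using h 0 0
  obtain ⟨h00, -⟩ := hpair h00 h00
  ext i j
  fin_cases i <;> fin_cases j <;> assumption

theorem relations_two_eq_bot (a b p q t : k) (ht : t ≠ 0) (ht2 : t ^ 2 ≠ 1) :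
    relations (braiding13 a b p q t ht) 2 = ⊥ := by
  refine (Submodule.eq_bot_iff _).2 fun u hu => ?_
  obtain ⟨μ, rfl⟩ := exists_eq_sum_of_mem_relations_two (Pi.basisFun k (Fin 3)) hu
  obtain rfl := eq_zero_of_add_sum_coeff13_eq_zero ht2
    (coord_add_sum_eq_zero (hasCoeffs_coeff13 a b p q t ht) hu)
  simp

end Quadratic

/-! ### The Nichols algebras of `ℜ_{1,3}` -/

section Presentation13

open Asymptotics Filter

variable {k : Type*} [Field k]

theorem adjoin_range_mk_X (R : Set (TensorAlgebra k (Fin 3 → k))) :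
    Algebra.adjoin k (Set.range fun j => Presented.mk R (X k j)) = ⊤ := by
  simpa only [X_eq] using Presented.adjoin_range_mk_ι (Pi.basisFun k (Fin 3)) R

theorem isMonomialBasis_and_gkDim_eq {c : Braiding k (Fin 3 → k)}
    {R : Set (TensorAlgebra k (Fin 3 → k))}
    (hJ : (definingIdeal c : Set (TensorAlgebra k (Fin 3 → k))) = TwoSidedIdeal.span R)
    {S : Set (ℕ × ℕ × ℕ)} (hstr : IsStraightening k (fun j => Presented.mk R (X k j)) S)
    (hli : LinearIndependent k fun e : S => mon (fun j => Presented.mk R (X k j)) e) {d : ℕ}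
    (hS : (fun n => ((expLE S n).ncard : ℝ)) =Θ[atTop] fun n => (n : ℝ) ^ d) :
    IsMonomialBasis c S ∧ gkDim k (NicholsAlgebra c) = d := by
  let ρ : TensorAlgebra k (Fin 3 → k) →ₐ[k] NicholsAlgebra c :=
    Presented.mk (definingIdeal c : Set (TensorAlgebra k (Fin 3 → k)))
  obtain ⟨f, hf⟩ : ∃ f : NicholsAlgebra c →ₐ[k] Presented R, ∀ w, f (ρ w) = Presented.mk R w :=
    Presented.exists_lift _ fun r hr => (Presented.mk_eq_zero_iff R r).2 (hJ.le hr)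
  obtain ⟨g, hg⟩ : ∃ g : Presented R →ₐ[k] NicholsAlgebra c, ∀ w, g (Presented.mk R w) = ρ w :=
    Presented.exists_lift _ fun r hr => Presented.mk_eq_zero (hJ.ge (TwoSidedIdeal.subset_span hr))
  have hstrρ : IsStraightening k (fun j => ρ (X k j)) S := by simpa only [hg] using hstr.map g
  have hliρ : LinearIndependent k fun e : S => mon (fun j => ρ (X k j)) e :=
    .of_comp f.toLinearMap <| by simpa [Function.comp_def, map_mon, hf] using hli
  have hgen : Algebra.adjoin k (Set.range fun j => ρ (X k j)) = ⊤ := adjoin_range_mk_X _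
  exact ⟨⟨hliρ, hstrρ.span_eq_top hgen⟩, hstrρ.gkDim_eq hgen hliρ hS⟩

theorem presentation13 {a b p q t : k} {ht : t ≠ 0} {R : Set (TensorAlgebra k (Fin 3 → k))}
    (hR : R ⊆ Set.range (pairMul k (Fin 3 → k)))
    {D : Fin 3 → Presented R →ₗ[k] Presented R}
    (hD : SkewCalculus (coeff13 a b p q t) (fun j => Presented.mk R (X k j)) D)
    {S : Set (ℕ × ℕ × ℕ)} (hstr : IsStraightening k (fun j => Presented.mk R (X k j)) S)
    {δ : S → ℕ} (htri : HasTriangularFunctionals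
      (fun e : S => mon (fun j => Presented.mk R (X k j)) e) δ (⨅ m, LinearMap.ker (D m))
      ⟨0, hstr.zero_mem⟩) {d : ℕ}
    (hS : (fun n => ((expLE S n).ncard : ℝ)) =Θ[atTop] fun n => (n : ℝ) ^ d) :
    (definingIdeal (braiding13 a b p q t ht) : Set (TensorAlgebra k (Fin 3 → k))) =
        TwoSidedIdeal.span R ∧
      IsMonomialBasis (braiding13 a b p q t ht) S ∧
      gkDim k (NicholsAlgebra (braiding13 a b p q t ht)) = d := by
  simp only [X_eq] at hD
  have hJ := definingIdeal_eq_span_of_iInf_ker_le (hasCoeffs_coeff13 a b p q t ht) hR hD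
    (by simpa [mon] using htri.le_span_singleton (hstr.span_eq_top (adjoin_range_mk_X R)))
  exact ⟨hJ, isMonomialBasis_and_gkDim_eq hJ hstr htri.linearIndependent hS⟩

theorem exists_skewCalculus13 (a b p q t : k) (R : Set (TensorAlgebra k (Fin 3 → k)))
    (hR : ∀ r ∈ R, skewRep (Pi.basisFun k (Fin 3)) (coeff13 a b p q t)
      (fun j => Presented.mk R (X k j)) r = 0) :
    ∃ D, SkewCalculus (coeff13 a b p q t) (fun j => Presented.mk R (X k j)) D := by
  simp only [X_eq] at hR ⊢
  exact Presented.exists_skewCalculus hR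

theorem skewRep_X {A : Type*} [Ring A] [Algebra k A] (C : Fin 3 → Fin 3 → Fin 3 → Fin 3 → k)
    (y : Fin 3 → A) (j : Fin 3) : skewRep (Pi.basisFun k (Fin 3)) C y (X k j) = skewOp C y j := by
  rw [X_eq, skewRep_ι]

theorem SymmRel.skewRep_eq_zero {A : Type*} [Ring A] [Algebra k A] {a b : k} {y : Fin 3 → A}
    (h : SymmRel a b y) (p q : k) :
    ∀ r ∈ relSymm a b, skewRep (Pi.basisFun k (Fin 3)) (coeff13 a b p q 1) y r = 0 :=
  (symmRel_iff a b _).2 (by simpa only [skewRep_X] using h.skewOp)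

theorem SkewRel.skewRep_eq_zero {A : Type*} [Ring A] [Algebra k A] {b : k} {y : Fin 3 → A}
    (h : SkewRel b y) (a p q : k) :
    ∀ r ∈ relSkew b, skewRep (Pi.basisFun k (Fin 3)) (coeff13 a b p q (-1)) y r = 0 :=
  (skewRel_iff b _).2 (by simpa only [skewRep_X] using h.skewOp)

theorem ExtRel.skewRep_eq_zero {A : Type*} [Ring A] [Algebra k A] {b p : k} {y : Fin 3 → A}
    (h : ExtRel b p y) (a : k) :
    ∀ r ∈ relExt b p, skewRep (Pi.basisFun k (Fin 3)) (coeff13 a b p 0 (-1)) y r = 0 :=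
  (extRel_iff b p _).2 (by simpa only [skewRep_X] using h.skewOp)

theorem X_mul_X_mem_range_pairMul (i j : Fin 3) :
    X k i * X k j ∈ LinearMap.range (pairMul k (Fin 3 → k)) :=
  ⟨x k i ⊗ₜ x k j, pairMul_tmul _ _⟩

theorem relSymm_subset_range_pairMul (a b : k) :
    relSymm a b ⊆ LinearMap.range (pairMul k (Fin 3 → k)) := by
  have hX := X_mul_X_mem_range_pairMul (k := k)
  simp only [relSymm, pow_two, Set.insert_subset_iff, Set.singleton_subset_iff, SetLike.mem_coe]
  exact ⟨sub_mem (hX _ _) (hX _ _),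
    sub_mem (sub_mem (hX _ _) (hX _ _)) (Submodule.smul_mem _ _ (hX _ _)),
    sub_mem (sub_mem (hX _ _) (hX _ _)) (Submodule.smul_mem _ _ (hX _ _))⟩

theorem relExt_subset_range_pairMul (b p : k) :
    relExt b p ⊆ LinearMap.range (pairMul k (Fin 3 → k)) := by
  have hX := X_mul_X_mem_range_pairMul (k := k)
  simp only [relExt, pow_two, Set.insert_subset_iff, Set.singleton_subset_iff, SetLike.mem_coe]
  exact ⟨add_mem (hX _ _) (hX _ _), add_mem (hX _ _) (hX _ _),
    sub_mem (add_mem (hX _ _) (hX _ _)) (Submodule.smul_mem _ _ (hX _ _)), hX _ _, hX _ _,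
    sub_mem (sub_mem (hX _ _) (Submodule.smul_mem _ _ (hX _ _)))
      (Submodule.smul_mem _ _ (hX _ _))⟩

theorem relSkew_subset_relExt (b p : k) : relSkew b ⊆ relExt b p := by
  intro r hr
  simp only [relSkew, relExt, Set.mem_insert_iff, Set.mem_singleton_iff] at hr ⊢
  tauto

theorem finrank_of_isMonomialBasis_B0 {c : Braiding k (Fin 3 → k)} (h : IsMonomialBasis c B0) :
    Module.finrank k (NicholsAlgebra c) = 8 := by
  rw [Module.finrank_eq_nat_card_basis (Module.Basis.mk h.1 h.2.ge), Nat.card_coe_set_eq, ncard_B0]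

variable [CharZero k]

theorem presentation13_symm (a b p q : k) (ht : (1 : k) ≠ 0) :
    (definingIdeal (braiding13 a b p q 1 ht) : Set (TensorAlgebra k (Fin 3 → k))) =
        TwoSidedIdeal.span (relSymm a b) ∧
      IsMonomialBasis (braiding13 a b p q 1 ht) B3 ∧
      gkDim k (NicholsAlgebra (braiding13 a b p q 1 ht)) = 3 := by
  have hR := relSymm_subset_range_pairMul a b
  have hrel := (symmRel_iff a b _).1 fun r => Presented.mk_eq_zero (R := relSymm a b)
  obtain ⟨D, hD⟩ := exists_skewCalculus13 a b p q 1 (relSymm a b) (hrel.skewRep_eq_zero p q)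
  obtain ⟨ε, hε⟩ := Presented.exists_augmentation hR
  exact presentation13 hR hD hrel.isStraightening
    (hD.hasTriangularFunctionals_symm fun j => hε _) isTheta_ncard_expLE_B3

theorem presentation13_skew (a b p : k) {q : k} (hq : q ≠ 0) (ht : (-1 : k) ≠ 0) :
    (definingIdeal (braiding13 a b p q (-1) ht) : Set (TensorAlgebra k (Fin 3 → k))) =
        TwoSidedIdeal.span (relSkew b) ∧
      IsMonomialBasis (braiding13 a b p q (-1) ht) B1 ∧
      gkDim k (NicholsAlgebra (braiding13 a b p q (-1) ht)) = 1 := by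
  have hR := (relSkew_subset_relExt b 0).trans (relExt_subset_range_pairMul b 0)
  have hrel := (skewRel_iff b _).1 fun r => Presented.mk_eq_zero (R := relSkew b)
  obtain ⟨D, hD⟩ := exists_skewCalculus13 a b p q (-1) (relSkew b) (hrel.skewRep_eq_zero a p q)
  obtain ⟨ε, hε⟩ := Presented.exists_augmentation hR
  simpa using presentation13 (ht := ht) hR hD hrel.isStraightening
    (hD.hasTriangularFunctionals_skew (adjoin_range_mk_X _) (fun j => hε _) _
      fun e he => ⟨he.1, he.2, .inl hq⟩)
    isTheta_ncard_expLE_B1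

theorem presentation13_ext (a b p : k) (ht : (-1 : k) ≠ 0) :
    (definingIdeal (braiding13 a b p 0 (-1) ht) : Set (TensorAlgebra k (Fin 3 → k))) =
        TwoSidedIdeal.span (relExt b p) ∧
      IsMonomialBasis (braiding13 a b p 0 (-1) ht) B0 ∧
      gkDim k (NicholsAlgebra (braiding13 a b p 0 (-1) ht)) = 0 := by
  have hR := relExt_subset_range_pairMul b p
  have hrel := (extRel_iff b p _).1 fun r => Presented.mk_eq_zero (R := relExt b p)
  obtain ⟨D, hD⟩ := exists_skewCalculus13 a b p 0 (-1) (relExt b p) (hrel.skewRep_eq_zero a)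
  obtain ⟨ε, hε⟩ := Presented.exists_augmentation hR
  simpa using presentation13 (ht := ht) hR hD hrel.isStraightening
    (hD.hasTriangularFunctionals_skew (adjoin_range_mk_X _) (fun j => hε _) _
      fun e he => ⟨he.1, he.2.1, .inr he.2.2⟩)
    isTheta_ncard_expLE_B0

end Presentation13

end Nichols

theorem proposition3p8 {k : Type*} [Field k] [CharZero k] (a b p q t : k) (ht : t ≠ 0) :
    let c := braiding13 a b p q t ht
    let x₁ := X k 0
    let x₂ := X k 1
    let x₃ := X k 2
    (t ^ 2 ≠ 1 → relations c 2 = ⊥) ∧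
    (t = 1 →
      (definingIdeal c : Set (TensorAlgebra k (Fin 3 → k))) =
          TwoSidedIdeal.span {x₂ * x₁ - x₁ * x₂, x₃ * x₁ - x₁ * x₃ - a • x₁ ^ 2,
            x₃ * x₂ - x₂ * x₃ - b • (x₁ * x₂)} ∧
        IsMonomialBasis c B3 ∧ gkDim k (NicholsAlgebra c) = 3) ∧
    (t = -1 → q ≠ 0 →
      (definingIdeal c : Set (TensorAlgebra k (Fin 3 → k))) =
          TwoSidedIdeal.span {x₂ * x₁ + x₁ * x₂, x₃ * x₁ + x₁ * x₃,
            x₃ * x₂ + x₂ * x₃ - b • (x₁ * x₂), x₁ ^ 2, x₂ ^ 2} ∧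
        IsMonomialBasis c B1 ∧ gkDim k (NicholsAlgebra c) = 1) ∧
    (t = -1 → q = 0 →
      (definingIdeal c : Set (TensorAlgebra k (Fin 3 → k))) =
          TwoSidedIdeal.span {x₂ * x₁ + x₁ * x₂, x₃ * x₁ + x₁ * x₃,
            x₃ * x₂ + x₂ * x₃ - b • (x₁ * x₂), x₁ ^ 2, x₂ ^ 2,
            x₃ ^ 2 - b • (x₁ * x₃) - p • (x₁ * x₂)} ∧
        IsMonomialBasis c B0 ∧ gkDim k (NicholsAlgebra c) = 0 ∧
        Module.finrank k (NicholsAlgebra c) = 8) := by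
  intro c x₁ x₂ x₃
  refine ⟨relations_two_eq_bot a b p q t ht, ?_, ?_, ?_⟩
  · rintro rfl
    exact presentation13_symm a b p q ht
  · rintro rfl hq
    exact presentation13_skew a b p hq ht
  · rintro rfl rfl
    obtain ⟨hideal, hbasis, hdim⟩ := presentation13_ext a b p ht
    exact ⟨hideal, hbasis, hdim, finrank_of_isMonomialBasis_B0 hbasis⟩
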